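/- All graphs are finite and simple. In the vertex colouring game on a graph $G$ with $k$ colours, Maker and Breaker alternately (Maker first) choose an uncoloured vertex and give it one of the $k$ colours, different from the colours of all its coloured neighbours; Maker wins if the whole of $G$ gets coloured, and Breaker wins otherwise. The game chromatic number $\chi_{\mathrm g}(G)$ is the least $k$ for which Maker has a winning strategy. In the vertex colouring game with blanks, Breaker (but not Maker) may instead use his turn to mark any unplayed vertex as blank; a blank is not a colour, and it does not restrict the colours allowed at adjacent vertices. This game ends as soon as no unplayed vertex can legally be given a (non-blank) colour, and Maker wins if all vertices have then been played, while Breaker wins otherwise (in particular, Breaker wins if playing a blank is his only legal move). Let $\chi_{\mathrm{gb}}(G)$ be the least number $k$ of colours, not counting blanks, for which Maker has a winning strategy in the game with blanks. Theorem. Every graph $G$ satisfies $\chi_{\mathrm g}(G) \le \chi_{\mathrm{gb}}(G)$. If moreover $G$ has $n \geq 6$ vertices and is not isomorphic to the $r$-partite Turán graph $T(2r,r)$ for any $r$, then $$\chi_{\mathrm{gb}}(G) - \chi(G) \le \lfloor n/2 \rfloor - 2,$$ and consequently $\chi_{\mathrm g}(G) - \chi(G) \le \lfloor n/2 \rfloor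 - 2$. -/

import Mathlib

namespace SimpleGraph

/-- The two players of the vertex colouring game; Maker moves first. -/
inductive Player
  | maker
  | breaker

/-- The state of a vertex during the game with `k` colours: not yet played, marked as blank,
or given one of the `k` colours. -/
inductive Mark (k : ℕ)
  | unplayed
  | blank
  | colour (c : Fin k)

/-- In the position `p`, the vertex `v` is unplayed and may legally be given the colour `c`:
no neighbour of `v` has this colour (blanks impose no restriction). -/
def LegalColour {V : Type*} (G : SimpleGraph V) {k : ℕ} (p : V → Mark k) (v : V) (c : Fin k) :
    Prop :=
  p v = Mark.unplayed ∧ ∀ w, G.Adj v w → p w ≠ Mark.colour c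

/-- `G.MakerWins blanks k P p` says that, on the finite graph `G` with `k` colours, Maker can force
a win from the position `p` when it is the turn of the player `P`. If `blanks = true`, Breaker
(and only Breaker) may also play a blank at any unplayed vertex; if `blanks = false`, this is the
usual vertex colouring game.

The game ends as soon as no unplayed vertex can legally be given a colour, and Maker wins
if all vertices have then been played. In particular Breaker wins if it is his turn
and his only legal moves are blanks: the constructor `breaker` requires a legal colour move. -/
inductive MakerWins {V : Type*} [DecidableEq V] (G : SimpleGraph V) (blanks : Bool) (k : ℕ) :
    Player → (V → Mark k) → Prop
  | finished (P : Player) (p : V → Mark k) (hp : ∀ v, p v ≠ Mark.unplayed) :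
      MakerWins G blanks k P p
  | maker (p : V → Mark k) (v : V) (c : Fin k) (hvc : G.LegalColour p v c)
      (hwin : MakerWins G blanks k Player.breaker (Function.update p v (Mark.colour c))) :
      MakerWins G blanks k Player.maker p
  | breaker (p : V → Mark k) (hlive : ∃ v c, G.LegalColour p v c)
      (hcolour : ∀ v c, G.LegalColour p v c →
        MakerWins G blanks k Player.maker (Function.update p v (Mark.colour c)))
      (hblank : blanks = true → ∀ v, p v = Mark.unplayed →
        MakerWins G blanks k Player.maker (Function.update p v Mark.blank)) :
      MakerWins G blanks k Player.breaker p

/-- The game chromatic number `χ_g(G)`: the least number of colours with which Maker, moving first,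
wins the vertex colouring game on `G` (with value `⊤` if there were no such number). -/
noncomputable def gameChromaticNumber {V : Type*} [DecidableEq V] (G : SimpleGraph V) : ℕ∞ :=
  ⨅ k ∈ {k : ℕ | G.MakerWins false k Player.maker (fun _ => Mark.unplayed)}, (k : ℕ∞)

/-- `χ_gb(G)`: the least number of colours (not counting blanks) with which Maker, moving first,
wins the vertex colouring game with blanks on `G` (with value `⊤` if there were no such number). -/
noncomputable def gameChromaticNumberBlanks {V : Type*} [DecidableEq V] (G : SimpleGraph V) :
    ℕ∞ :=
  ⨅ k ∈ {k : ℕ | G.MakerWins true k Player.maker (fun _ => Mark.unplayed)}, (k : ℕ∞)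

end SimpleGraph

/-! Blanks only widen Breaker's choice, whence `χ_g ≤ χ_gb`. The rest is a strategy for Maker in the
game with blanks with `k = χ(G) + ⌊n/2⌋ - 2` colours.

Reserves. Maker keeps a proper colouring that extends the position, and some unused colours which it
avoids. If Breaker disturbs the plan with a colour `c`, then `c` is replaced in the rest of the plan
by a reserve colour; a reply in a reserve colour uses up that colour. Blanks cost nothing, nor does
a new colour where the plan has a new colour. Hence Maker wins with one reserve colour for each move
of Breaker, except for a move which ends the game (`Plan.mWin`). With `t = χ(G)` this takes `t +
⌊n/2⌋` colours for odd `n` and `t + n/2 - 1` for even `n`. Maker is short of two colours or of one,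
and has to make Breaker waste that many moves.

Wasted moves. After Maker has opened with a new colour at `v`, the other vertices `A` of the class
of `v` may repeat it, and only the set `F` outside the class needs new colours (`Layout`). A reply
hurts only if it puts a new colour into `A` or destroys the last safe colour of `A`. To the former
Maker answers inside `A`, which then has two safe colours, so that the latter is no longer a threat.
When `A` is full Breaker has to waste a move, unless parity lets him take its last vertex
(`bWin_of_one_save`, `bWin_of_two_saves`). If he destroys the safe colour at once, two vertices and
one unused colour are gone and the deficit is unchanged, so induction applies.

The graph `T(2r, r)` is a real exception: with `2r - 2` colours Breaker answers in the mate of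
Maker's vertex with a second new colour, and the last pair finds no colour. The even induction
(`evenWin`) must therefore avoid leaving such a cocktail party graph. The odd one (`oddWinTwo`) has
no exception, since some class is odd; its case of two classes is settled by filling up the smaller
side. Boards of six and seven vertices are settled by counting free neighbours (`Secure`). -/

namespace SimpleGraph
namespace ColouringGame

set_option linter.unusedSectionVars false

open Finset Function

/-- Dropping Breaker's right to play blanks only helps Maker. -/
lemma makerWins_false {V : Type*} [DecidableEq V] {G : SimpleGraph V} {k : ℕ} {P : Player}
    {p : V → Mark k} (h : G.MakerWins true k P p) : G.MakerWins false k P p := by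
  induction h with
  | finished P p hp => exact MakerWins.finished P p hp
  | maker p v c hvc _ ih => exact MakerWins.maker p v c hvc ih
  | breaker p hlive _ _ ih _ => exact MakerWins.breaker p hlive ih (by simp)

/-! ### Positions, seen and unused colours, replies -/

variable {V : Type*} [Fintype V] [DecidableEq V] {G : SimpleGraph V} {k : ℕ}

noncomputable instance : DecidableEq (Mark k) := Classical.decEq _

/-- The set of vertices which have not been played yet. -/
noncomputable def unplayed (p : V → Mark k) : Finset V := {v | p v = Mark.unplayed}

open Classical in
/-- The set of colours which do not occur in the position `p`. -/
noncomputable def unused (p : V → Mark k) : Finset (Fin k) := {c | ∀ w, p w ≠ Mark.colour c}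

open Classical in
/-- The set of colours which occur on neighbours of `v`. -/
noncomputable def seen (G : SimpleGraph V) (p : V → Mark k) (v : V) : Finset (Fin k) :=
  {c | ∃ w, G.Adj v w ∧ p w = Mark.colour c}

/-- Maker wins the game with blanks from `p` when it is Maker's turn. -/
abbrev MWin (G : SimpleGraph V) (p : V → Mark k) : Prop := G.MakerWins true k Player.maker p

/-- Maker wins the game with blanks from `p` when it is Breaker's turn. -/
abbrev BWin (G : SimpleGraph V) (p : V → Mark k) : Prop := G.MakerWins true k Player.breaker p

/-- Playing the mark `x` at `w` is a legal move of Breaker. -/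
def IsReply (G : SimpleGraph V) (p : V → Mark k) (w : V) (x : Mark k) : Prop :=
  w ∈ unplayed p ∧ (x = Mark.blank ∨ ∃ c, c ∉ seen G p w ∧ x = Mark.colour c)

variable {p : V → Mark k} {u v w : V} {c : Fin k} {x : Mark k}

lemma mem_unplayed : v ∈ unplayed p ↔ p v = Mark.unplayed := by simp [unplayed]

lemma mem_unused : c ∈ unused p ↔ ∀ w, p w ≠ Mark.colour c := by simp [unused]

lemma mem_seen : c ∈ seen G p v ↔ ∃ w, G.Adj v w ∧ p w = Mark.colour c := by simp [seen]

lemma notMem_seen_of_unused (hc : c ∈ unused p) : c ∉ seen G p v := by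
  rw [mem_seen]
  rintro ⟨w, -, hw⟩
  exact mem_unused.1 hc w hw

lemma legalColour_iff : G.LegalColour p v c ↔ v ∈ unplayed p ∧ c ∉ seen G p v := by
  simp [LegalColour, mem_unplayed, mem_seen]

lemma unplayed_update (hx : x ≠ Mark.unplayed) :
    unplayed (update p w x) = (unplayed p).erase w := by
  ext v
  rcases eq_or_ne v w with rfl | h <;> simp [mem_unplayed, *]

lemma mem_unused_update (hw : w ∈ unplayed p) :
    c ∈ unused (update p w x) ↔ c ∈ unused p ∧ x ≠ Mark.colour c := by
  rw [mem_unplayed] at hw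
  simp only [mem_unused]
  constructor
  · intro h
    refine ⟨fun v => ?_, by simpa using h w⟩
    rcases eq_or_ne v w with rfl | hv
    · simp [hw]
    · simpa [hv] using h v
  · rintro ⟨h, hx⟩ v
    rcases eq_or_ne v w with rfl | hv
    · simpa using hx
    · simpa [hv] using h v

lemma mem_seen_update (hw : w ∈ unplayed p) :
    c ∈ seen G (update p w x) v ↔ c ∈ seen G p v ∨ (G.Adj v w ∧ x = Mark.colour c) := by
  rw [mem_unplayed] at hw
  simp only [mem_seen]
  constructor
  · rintro ⟨u, hu, h⟩
    rcases eq_or_ne u w with rfl | hne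
    · exact Or.inr ⟨hu, by simpa using h⟩
    · exact Or.inl ⟨u, hu, by simpa [hne] using h⟩
  · rintro (⟨u, hu, h⟩ | ⟨h, hx⟩)
    · have hne : u ≠ w := by rintro rfl; simp [hw] at h
      exact ⟨u, hu, by simpa [hne] using h⟩
    · exact ⟨w, h, by simpa using hx⟩

lemma unused_update_colour (hw : w ∈ unplayed p) :
    unused (update p w (Mark.colour c)) = (unused p).erase c := by
  ext d
  rw [mem_unused_update hw, mem_erase]
  simp [and_comm, eq_comm]

lemma unused_update_blank (hw : w ∈ unplayed p) :
    unused (update p w Mark.blank) = unused p := by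
  ext d
  rw [mem_unused_update hw]
  simp

lemma IsReply.ne_unplayed (h : IsReply G p w x) : x ≠ Mark.unplayed := by
  rcases h.2 with rfl | ⟨c, -, rfl⟩ <;> simp

lemma IsReply.unplayed_eq (h : IsReply G p w x) :
    unplayed (update p w x) = (unplayed p).erase w := unplayed_update h.ne_unplayed

lemma IsReply.card (h : IsReply G p w x) :
    #(unplayed (update p w x)) + 1 = #(unplayed p) := by
  rw [h.unplayed_eq, card_erase_add_one h.1]

lemma IsReply.card_unused_le (h : IsReply G p w x) :
    #(unused p) ≤ #(unused (update p w x)) + 1 := by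
  rcases h.2 with rfl | ⟨c, -, rfl⟩
  · rw [unused_update_blank h.1]; omega
  · rw [unused_update_colour h.1]
    have := pred_card_le_card_erase (s := unused p) (a := c)
    omega

lemma isReply_colour (hw : w ∈ unplayed p) (hc : c ∉ seen G p w) :
    IsReply G p w (Mark.colour c) := ⟨hw, Or.inr ⟨c, hc, rfl⟩⟩

lemma card_unused_update_of_mem (hw : w ∈ unplayed p) (hc : c ∈ unused p) :
    #(unused (update p w (Mark.colour c))) + 1 = #(unused p) := by
  rw [unused_update_colour hw, card_erase_add_one hc]

lemma unused_update_of_notMem (hw : w ∈ unplayed p) (hc : c ∉ unused p) :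
    unused (update p w (Mark.colour c)) = unused p := by
  rw [unused_update_colour hw, erase_eq_of_notMem hc]

lemma finished_of_unplayed_eq_empty {P : Player} (h : unplayed p = ∅) :
    G.MakerWins true k P p :=
  MakerWins.finished P p fun v hv => by
    have := mem_unplayed.2 hv
    simp [h] at this

lemma mWin_of_move (hv : v ∈ unplayed p) (hc : c ∉ seen G p v)
    (h : BWin G (update p v (Mark.colour c))) : MWin G p :=
  MakerWins.maker p v c (legalColour_iff.2 ⟨hv, hc⟩) h

lemma bWin_of_reply (hlive : ∃ v ∈ unplayed p, ∃ c, c ∉ seen G p v)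
    (h : ∀ w x, IsReply G p w x → MWin G (update p w x)) : BWin G p := by
  obtain ⟨v, hv, c, hc⟩ := hlive
  refine MakerWins.breaker p ⟨v, c, legalColour_iff.2 ⟨hv, hc⟩⟩ (fun v c hvc => ?_) fun _ v hv => ?_
  · rw [legalColour_iff] at hvc
    exact h _ _ (isReply_colour hvc.1 hvc.2)
  · exact h _ _ ⟨mem_unplayed.2 hv, Or.inl rfl⟩

/-! ### Secure vertices -/

open Classical in
/-- The unplayed neighbours of a vertex. -/
noncomputable def freeNbrs (G : SimpleGraph V) (p : V → Mark k) (v : V) : Finset V :=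
  {u ∈ unplayed p | G.Adj v u}

lemma mem_freeNbrs : u ∈ freeNbrs G p v ↔ u ∈ unplayed p ∧ G.Adj v u := by simp [freeNbrs]

/-- A vertex is secure if it can never run out of colours, either for lack of neighbours or
because some colour is blocked at all its unplayed neighbours. -/
def Secure (G : SimpleGraph V) (p : V → Mark k) (v : V) : Prop :=
  #(seen G p v) + #(freeNbrs G p v) < k ∨
    ∃ c, c ∉ seen G p v ∧ ∀ u ∈ unplayed p, G.Adj v u → c ∈ seen G p u

lemma exists_notMem_seen (h : #(seen G p v) < k) : ∃ c, c ∉ seen G p v := by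
  by_contra! hc
  have : seen G p v = univ := eq_univ_iff_forall.2 hc
  simp [this] at h

lemma Secure.exists_legal (h : Secure G p v) : ∃ c, c ∉ seen G p v := by
  rcases h with h | ⟨c, hc, -⟩
  · exact exists_notMem_seen (by omega)
  · exact ⟨c, hc⟩

lemma freeNbrs_update (h : IsReply G p w x) :
    freeNbrs G (update p w x) v = (freeNbrs G p v).erase w := by
  ext u
  simp [mem_freeNbrs, h.unplayed_eq, and_assoc]

lemma seen_update_subset (hw : w ∈ unplayed p) :
    seen G (update p w (Mark.colour c)) v ⊆ insert c (seen G p v) := by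
  intro d hd
  rcases (mem_seen_update hw).1 hd with h | ⟨-, h⟩
  · exact mem_insert_of_mem h
  · simp only [Mark.colour.injEq] at h
    simp [h]

lemma seen_update_blank (hw : w ∈ unplayed p) :
    seen G (update p w Mark.blank) v = seen G p v := by
  ext d
  simp [mem_seen_update hw]

lemma seen_update_of_not_adj (hw : w ∈ unplayed p) (h : ¬ G.Adj v w) :
    seen G (update p w x) v = seen G p v := by
  ext d
  simp [mem_seen_update hw, h]

lemma card_seen_update_le (h : IsReply G p w x) :
    #(seen G (update p w x) v) ≤ #(seen G p v) + 1 := by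
  rcases h.2 with rfl | ⟨c, -, rfl⟩
  · rw [seen_update_blank h.1]; omega
  · exact (card_le_card (seen_update_subset h.1)).trans (card_insert_le _ _)

/-- In the first alternative a move next to `v` removes a free neighbour and adds at most one seen
colour. In the second, `c` cannot be played next to `v`, and blocked colours stay blocked. -/
lemma Secure.update (h : Secure G p v) (hr : IsReply G p w x) : Secure G (update p w x) v := by
  rcases h with h | ⟨c, hc, hu⟩
  · left
    rw [freeNbrs_update hr]
    by_cases hvw : G.Adj v w
    · have h1 := card_seen_update_le (v := v) hr
      have h2 := card_erase_add_one (mem_freeNbrs.2 ⟨hr.1, hvw⟩)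
      omega
    · rw [seen_update_of_not_adj hr.1 hvw]
      have := card_erase_le (s := freeNbrs G p v) (a := w)
      omega
  · right
    refine ⟨c, ?_, fun u hu' huv => ?_⟩
    · rw [mem_seen_update hr.1]
      rintro (h | ⟨h, rfl⟩)
      · exact hc h
      · rcases hr.2 with h' | ⟨d, hd, h'⟩
        · simp at h'
        · simp only [Mark.colour.injEq] at h'
          subst h'
          exact hd (hu w hr.1 h)
    · rw [hr.unplayed_eq, mem_erase] at hu'
      exact (mem_seen_update hr.1).2 (Or.inl (hu u hu'.2 huv))

/-- Security survives every move, so any legal moves will do. -/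
lemma win_of_secure (P : Player) (h : ∀ v ∈ unplayed p, Secure G p v) :
    G.MakerWins true k P p := by
  induction hm : #(unplayed p) generalizing p P with
  | zero => exact finished_of_unplayed_eq_empty (card_eq_zero.1 hm)
  | succ m ih =>
    obtain ⟨v, hv⟩ := card_pos.1 (by omega : 0 < #(unplayed p))
    obtain ⟨c, hc⟩ := (h v hv).exists_legal
    have key : ∀ w x, IsReply G p w x → ∀ P, G.MakerWins true k P (update p w x) := by
      intro w x hr P
      refine ih P (fun u hu => ?_) ?_
      · rw [hr.unplayed_eq, mem_erase] at hu
        exact (h u hu.2).update hr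
      · have := hr.card; omega
    cases P with
    | maker => exact mWin_of_move hv hc (key _ _ (isReply_colour hv hc) _)
    | breaker => exact bWin_of_reply ⟨v, hv, c, hc⟩ fun w x hr => key w x hr _

lemma card_seen_add_card_unused_le : #(seen G p v) + #(unused p) ≤ k := by
  rw [← card_union_of_disjoint]
  · simpa using card_le_univ (seen G p v ∪ unused p)
  · exact Finset.disjoint_left.2 fun c hc hc' => notMem_seen_of_unused hc' hc

/-- An unused colour is seen nowhere, so at most `k - #(unused p)` colours are seen. In this form
degree bounds settle the small cases. -/
lemma secure_of_card_lt (h : #(freeNbrs G p v) < #(unused p)) : Secure G p v := by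
  left
  have := card_seen_add_card_unused_le (G := G) (p := p) (v := v)
  omega

/-- A colour which is legal on all of an independent set of unplayed vertices wins. -/
lemma win_of_indep (P : Player) (hi : ∀ u ∈ unplayed p, ∀ v ∈ unplayed p, ¬ G.Adj u v)
    (hc : ∀ v ∈ unplayed p, c ∉ seen G p v) : G.MakerWins true k P p :=
  win_of_secure P fun v hv => Or.inr ⟨c, hc v hv, fun u hu h => (hi v hv u hu h).elim⟩

lemma win_of_indep_of_unused (P : Player)
    (hi : ∀ u ∈ unplayed p, ∀ v ∈ unplayed p, ¬ G.Adj u v) (hU : 1 ≤ #(unused p)) :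
    G.MakerWins true k P p := by
  obtain ⟨c, hc⟩ := card_pos.1 hU
  exact win_of_indep P hi fun v _ => notMem_seen_of_unused hc

/-! ### Extension plans -/

/-- `f` extends the position to a proper colouring and leaves the unused colours in `Z` aside. -/
structure Plan (G : SimpleGraph V) (p : V → Mark k) (f : V → Fin k) (Z : Finset (Fin k)) :
    Prop where
  legal : ∀ v ∈ unplayed p, f v ∉ seen G p v
  proper : ∀ u ∈ unplayed p, ∀ v ∈ unplayed p, G.Adj u v → f u ≠ f v
  notMem : ∀ v ∈ unplayed p, f v ∉ Z
  subset : Z ⊆ unused p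

variable {f : V → Fin k} {Z : Finset (Fin k)}

lemma Plan.blank (h : Plan G p f Z) (hw : w ∈ unplayed p) :
    Plan G (update p w Mark.blank) f Z := by
  have hu : unplayed (update p w Mark.blank) = (unplayed p).erase w := unplayed_update (by simp)
  constructor
  · intro v hv
    rw [hu, mem_erase] at hv
    rw [seen_update_blank hw]
    exact h.legal v hv.2
  · intro u hu' v hv
    rw [hu, mem_erase] at hu' hv
    exact h.proper u hu'.2 v hv.2
  · intro v hv
    rw [hu, mem_erase] at hv
    exact h.notMem v hv.2
  · rw [unused_update_blank hw]
    exact h.subset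

lemma Plan.colour (h : Plan G p f Z) (hw : w ∈ unplayed p) (hcZ : c ∉ Z)
    (hc : ∀ v ∈ unplayed p, G.Adj v w → f v ≠ c) :
    Plan G (update p w (Mark.colour c)) f Z := by
  have hu : unplayed (update p w (Mark.colour c)) = (unplayed p).erase w :=
    unplayed_update (by simp)
  constructor
  · intro v hv
    rw [hu, mem_erase] at hv
    rw [mem_seen_update hw]
    rintro (h' | ⟨h', h''⟩)
    · exact h.legal v hv.2 h'
    · simp only [Mark.colour.injEq] at h''
      exact hc v hv.2 h' h''.symm
  · intro u hu' v hv
    rw [hu, mem_erase] at hu' hv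
    exact h.proper u hu'.2 v hv.2
  · intro v hv
    rw [hu, mem_erase] at hv
    exact h.notMem v hv.2
  · rw [unused_update_colour hw]
    exact subset_erase.2 ⟨h.subset, hcZ⟩

/-- Playing according to the plan. -/
lemma Plan.play (h : Plan G p f Z) (hw : w ∈ unplayed p) :
    Plan G (update p w (Mark.colour (f w))) f Z :=
  h.colour hw (h.notMem w hw) fun v hv hvw => h.proper v hv w hw hvw

/-- Exchanging two unused colours in a plan. -/
lemma Plan.swap (h : Plan G p f Z) {c d : Fin k} (hc : c ∈ unused p) (hd : d ∈ unused p) :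
    Plan G p (fun v => Equiv.swap c d (f v)) (Z.map (Equiv.swap c d).toEmbedding) := by
  have key : ∀ e, e ∈ unused p → Equiv.swap c d e ∈ unused p := by
    intro e he
    by_cases h1 : e = c
    · subst h1; simpa using hd
    · by_cases h2 : e = d
      · subst h2; simpa using hc
      · rwa [Equiv.swap_apply_of_ne_of_ne h1 h2]
  constructor
  · intro v hv
    by_cases h1 : f v = c
    · simp only [h1, Equiv.swap_apply_left]; exact notMem_seen_of_unused hd
    · by_cases h2 : f v = d
      · simp only [h2, Equiv.swap_apply_right]; exact notMem_seen_of_unused hc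
      · simp only [Equiv.swap_apply_of_ne_of_ne h1 h2]; exact h.legal v hv
  · intro u hu v hv huv
    simpa using h.proper u hu v hv huv
  · intro v hv
    simpa using h.notMem v hv
  · intro e he
    rw [mem_map] at he
    obtain ⟨e', he', rfl⟩ := he
    exact key e' (h.subset he')

/-- A new colour played by Breaker where the plan has a new colour does no harm. -/
lemma Plan.exists_colour_new (h : Plan G p f Z) (hw : w ∈ unplayed p) (hfw : f w ∈ unused p)
    (hc : c ∈ unused p) :
    ∃ f' Z', Plan G (update p w (Mark.colour c)) f' Z' ∧ #Z' = #Z := by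
  have h' := (h.swap hc hfw).play hw
  rw [Equiv.swap_apply_right] at h'
  exact ⟨_, _, h', card_map _⟩

/-- Any move of Breaker costs at most one reserve colour. -/
lemma Plan.exists_reply (h : Plan G p f Z) (hr : IsReply G p w x) (hZ : 1 ≤ #Z) :
    ∃ f' Z', Plan G (Function.update p w x) f' Z' ∧ #Z ≤ #Z' + 1 := by
  rcases hr.2 with rfl | ⟨c, hc, rfl⟩
  · exact ⟨f, Z, h.blank hr.1, by omega⟩
  -- A reserve colour is simply dropped; any other colour is replaced throughout the plan by some `z
  -- ∈ Z`, which the plan does not use.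
  by_cases hcZ : c ∈ Z
  · have h' : Plan G p f (Z.erase c) :=
      ⟨h.legal, h.proper, fun v hv hm => h.notMem v hv (mem_of_mem_erase hm),
        (erase_subset _ _).trans h.subset⟩
    refine ⟨f, Z.erase c, h'.colour hr.1 (by simp) ?_, (card_erase_add_one hcZ).ge⟩
    rintro v hv - rfl
    exact h.notMem v hv hcZ
  · obtain ⟨z, hz⟩ := card_pos.1 hZ
    have hzc : z ≠ c := by rintro rfl; exact hcZ hz
    have h' : Plan G p (fun v => if f v = c then z else f v) (Z.erase z) := by
      constructor
      · intro v hv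
        split_ifs
        · exact notMem_seen_of_unused (h.subset hz)
        · exact h.legal v hv
      · intro u hu v hv huv
        have h1 := h.proper u hu v hv huv
        have h2 := h.notMem u hu
        have h3 := h.notMem v hv
        split_ifs with h4 h5 h5
        · exact (h1 (h4.trans h5.symm)).elim
        · rintro rfl; exact h3 hz
        · rintro rfl; exact h2 hz
        · exact h1
      · intro v hv
        split_ifs
        · simp
        · exact fun hm => h.notMem v hv (mem_of_mem_erase hm)
      · exact (erase_subset _ _).trans h.subset
    refine ⟨_, _, h'.colour hr.1 (fun hm => hcZ (mem_of_mem_erase hm)) ?_,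
      (card_erase_add_one hz).ge⟩
    intro v _ _
    split_ifs with h4
    · exact hzc
    · exact h4

/-- Maker wins if the plan has a reserve colour for every move of Breaker but the last one. -/
lemma Plan.mWin (h : Plan G p f Z) (hm : #(unplayed p) ≤ 2 * #Z + 2) : MWin G p := by
  induction hn : #(unplayed p) using Nat.strong_induction_on generalizing p f Z with
  | _ n ih =>
  rcases (unplayed p).eq_empty_or_nonempty with h0 | ⟨v, hv⟩
  · exact finished_of_unplayed_eq_empty h0
  refine mWin_of_move hv (h.legal v hv) ?_
  have hr := isReply_colour hv (h.legal v hv)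
  have h1 := h.play hv
  have hc := hr.card
  rcases (unplayed (update p v (Mark.colour (f v)))).eq_empty_or_nonempty with h0 | ⟨u, hu⟩
  · exact finished_of_unplayed_eq_empty h0
  refine bWin_of_reply ⟨u, hu, f u, h1.legal u hu⟩ fun w x hr' => ?_
  have hc' := hr'.card
  by_cases hZ : 1 ≤ #Z
  · obtain ⟨f', Z', hp, hZ'⟩ := h1.exists_reply hr' hZ
    exact ih _ (by omega) hp (by omega) rfl
  -- Without reserve there were at most two vertices, so Breaker's move was the last of the game.
  · exact finished_of_unplayed_eq_empty (card_eq_zero.1 (by omega))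

/-! ### Layouts -/

/-- `g` is a proper colouring of the subgraph induced on `S`. -/
def ProperOn (G : SimpleGraph V) (S : Finset V) (g : V → ℕ) : Prop :=
  ∀ u ∈ S, ∀ v ∈ S, G.Adj u v → g u ≠ g v

/-- The subgraph induced on `S` can be properly coloured with `t` colours. -/
def Col (G : SimpleGraph V) (S : Finset V) (t : ℕ) : Prop :=
  ∃ g : V → ℕ, ProperOn G S g ∧ #(S.image g) ≤ t

variable {S T A B F : Finset V} {g : V → ℕ} {s t : ℕ}

lemma ProperOn.mono (h : ProperOn G S g) (hT : T ⊆ S) : ProperOn G T g :=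
  fun u hu v hv => h u (hT hu) v (hT hv)

lemma Col.mono (h : Col G S t) (hT : T ⊆ S) : Col G T t := by
  obtain ⟨g, hg, hc⟩ := h
  exact ⟨g, hg.mono hT, (card_le_card (image_subset_image hT)).trans hc⟩

lemma Col.pos (h : Col G S t) (hS : S.Nonempty) : 1 ≤ t := by
  obtain ⟨g, -, hc⟩ := h
  exact (card_pos.2 (hS.image g)).trans_le hc

/-- Deleting a colour class. -/
lemma ProperOn.card_image_filter_ne (hv : v ∈ S) :
    #({u ∈ S | g u ≠ g v}.image g) + 1 ≤ #(S.image g) := by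
  rw [← card_erase_add_one (mem_image_of_mem g hv)]
  gcongr
  intro c hc
  obtain ⟨u, hu, rfl⟩ := mem_image.1 hc
  rw [mem_filter] at hu
  exact mem_erase.2 ⟨hu.2, mem_image_of_mem g hu.1⟩

lemma ProperOn.col_filter_ne (h : ProperOn G S g) (hv : v ∈ S) (hc : #(S.image g) ≤ t) :
    Col G {u ∈ S | g u ≠ g v} (t - 1) := by
  refine ⟨g, h.mono (filter_subset _ _), ?_⟩
  have := ProperOn.card_image_filter_ne (g := g) hv
  omega

lemma Col.insert_indep (h : Col G S t) (hT : ∀ u ∈ T, ∀ v ∈ T, ¬ G.Adj u v) :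
    Col G (T ∪ S) (t + 1) := by
  obtain ⟨g, hg, hc⟩ := h
  refine ⟨fun v => if v ∈ T then 0 else g v + 1, fun u hu v hv huv => ?_, ?_⟩
  · by_cases h1 : u ∈ T <;> by_cases h2 : v ∈ T
    · exact (hT u h1 v h2 huv).elim
    · simp [h1, h2]
    · simp [h1, h2]
    · simp only [mem_union, h1, h2, false_or] at hu hv
      simpa [h1, h2] using hg u hu v hv huv
  · have : (T ∪ S).image (fun v => if v ∈ T then 0 else g v + 1) ⊆
        insert 0 ((S.image g).image (· + 1)) := by
      intro d hd
      obtain ⟨v, hv, rfl⟩ := mem_image.1 hd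
      by_cases h1 : v ∈ T
      · simp [h1]
      · simp only [mem_union, h1, false_or] at hv
        simp only [h1, if_false]
        exact mem_insert_of_mem (mem_image_of_mem (· + 1) (mem_image_of_mem g hv))
    have h1 := card_le_card this
    have h2 := card_insert_le 0 ((S.image g).image (· + 1))
    have h3 := card_image_le (s := S.image g) (f := (· + 1))
    omega

/-- The unplayed vertices are split into two independent sets `A` and `B` at which the used colours
from `ΓA` and `ΓB` are legal, and a set `F` which is properly colourable with `t` colours. -/
structure Layout (G : SimpleGraph V) (p : V → Mark k) (A B F : Finset V)
    (ΓA ΓB : Finset (Fin k)) (t : ℕ) : Prop where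
  cover : unplayed p = A ∪ B ∪ F
  disjAB : Disjoint A B
  disjAF : Disjoint A F
  disjBF : Disjoint B F
  indepA : ∀ u ∈ A, ∀ v ∈ A, ¬ G.Adj u v
  indepB : ∀ u ∈ B, ∀ v ∈ B, ¬ G.Adj u v
  safeA : ∀ v ∈ A, ∀ c ∈ ΓA, c ∉ seen G p v
  safeB : ∀ v ∈ B, ∀ c ∈ ΓB, c ∉ seen G p v
  usedA : Disjoint ΓA (unused p)
  usedB : Disjoint ΓB (unused p)
  disjΓ : Disjoint ΓA ΓB
  neA : A.Nonempty → ΓA.Nonempty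
  neB : B.Nonempty → ΓB.Nonempty
  col : Col G F t

variable {ΓA ΓB : Finset (Fin k)}

namespace Layout

lemma symm (h : Layout G p A B F ΓA ΓB t) : Layout G p B A F ΓB ΓA t :=
  ⟨by rw [h.cover, union_comm A B], h.disjAB.symm, h.disjBF, h.disjAF, h.indepB, h.indepA,
    h.safeB, h.safeA, h.usedB, h.usedA, h.disjΓ.symm, h.neB, h.neA, h.col⟩

lemma card_eq (h : Layout G p A B F ΓA ΓB t) : #(unplayed p) = #A + #B + #F := by
  rw [h.cover, card_union_of_disjoint, card_union_of_disjoint h.disjAB]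
  exact disjoint_union_left.2 ⟨h.disjAF, h.disjBF⟩

lemma memA (h : Layout G p A B F ΓA ΓB t) (hv : v ∈ A) : v ∈ unplayed p := by
  simp [h.cover, hv]

lemma memF (h : Layout G p A B F ΓA ΓB t) (hv : v ∈ F) : v ∈ unplayed p := by
  simp [h.cover, hv]

lemma mem_cases (h : Layout G p A B F ΓA ΓB t) (hv : v ∈ unplayed p) : v ∈ A ∨ v ∈ B ∨ v ∈ F := by
  simpa [h.cover, or_assoc] using hv

lemma pos (h : Layout G p A B F ΓA ΓB t) (hF : F.Nonempty) : 1 ≤ t := h.col.pos hF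

lemma ofCol (h : Col G (unplayed p) t) : Layout G p ∅ ∅ (unplayed p) ∅ ∅ t := by
  constructor <;> simp [h]

/-- Forgetting some of the colours which are safe on `A`. -/
lemma shrink (h : Layout G p A B F ΓA ΓB t) {Γ : Finset (Fin k)} (hΓ : Γ ⊆ ΓA)
    (hne : A.Nonempty → Γ.Nonempty) : Layout G p A B F Γ ΓB t :=
  ⟨h.cover, h.disjAB, h.disjAF, h.disjBF, h.indepA, h.indepB,
    fun v hv c hc => h.safeA v hv c (hΓ hc),
    h.safeB, disjoint_of_subset_left hΓ h.usedA, h.usedB, disjoint_of_subset_left hΓ h.disjΓ, hne,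
    h.neB, h.col⟩

/-- Forgetting that `A` is safe. -/
lemma demote (h : Layout G p A B F ΓA ΓB t) : Layout G p ∅ B (A ∪ F) ∅ ΓB (t + 1) where
  cover := by rw [h.cover]; ext; simp; tauto
  disjAB := by simp
  disjAF := by simp
  disjBF := disjoint_union_right.2 ⟨h.disjAB.symm, h.disjBF⟩
  indepA := by simp
  indepB := h.indepB
  safeA := by simp
  safeB := h.safeB
  usedA := by simp
  usedB := h.usedB
  disjΓ := by simp
  neA := by simp
  neB := h.neB
  col := h.col.insert_indep h.indepA

/-- A move of Breaker which does not use a safe colour. -/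
lemma reply (h : Layout G p A B F ΓA ΓB t) (hr : IsReply G p w x)
    (hA : ∀ c ∈ ΓA, x ≠ Mark.colour c) (hB : ∀ c ∈ ΓB, x ≠ Mark.colour c) :
    Layout G (update p w x) (A.erase w) (B.erase w) (F.erase w) ΓA ΓB t where
  cover := by rw [hr.unplayed_eq, h.cover, erase_union_distrib, erase_union_distrib]
  disjAB := h.disjAB.mono (erase_subset _ _) (erase_subset _ _)
  disjAF := h.disjAF.mono (erase_subset _ _) (erase_subset _ _)
  disjBF := h.disjBF.mono (erase_subset _ _) (erase_subset _ _)
  indepA u hu v hv := h.indepA u (mem_of_mem_erase hu) v (mem_of_mem_erase hv)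
  indepB u hu v hv := h.indepB u (mem_of_mem_erase hu) v (mem_of_mem_erase hv)
  safeA v hv c hc := by
    rw [mem_seen_update hr.1]
    rintro (h' | ⟨-, h'⟩)
    · exact h.safeA v (mem_of_mem_erase hv) c hc h'
    · exact hA c hc h'
  safeB v hv c hc := by
    rw [mem_seen_update hr.1]
    rintro (h' | ⟨-, h'⟩)
    · exact h.safeB v (mem_of_mem_erase hv) c hc h'
    · exact hB c hc h'
  usedA := Finset.disjoint_left.2 fun c hc hc' =>
    Finset.disjoint_left.1 h.usedA hc ((mem_unused_update hr.1).1 hc').1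
  usedB := Finset.disjoint_left.2 fun c hc hc' =>
    Finset.disjoint_left.1 h.usedB hc ((mem_unused_update hr.1).1 hc').1
  disjΓ := h.disjΓ
  neA hA := h.neA (hA.mono (erase_subset _ _))
  neB hB := h.neB (hB.mono (erase_subset _ _))
  col := h.col.mono (erase_subset _ _)

lemma notMemB (h : Layout G p A B F ΓA ΓB t) (hc : c ∈ unused p ∨ c ∈ ΓA) : c ∉ ΓB := fun hB =>
  hc.elim (Finset.disjoint_left.1 h.usedB hB) fun hA => Finset.disjoint_left.1 h.disjΓ hA hB

/-- A move of either player in `A`, in a new colour or a colour which is safe on `A`. -/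
lemma colour_left (h : Layout G p A B F ΓA ΓB t) (hw : w ∈ A) (hc : c ∈ unused p ∨ c ∈ ΓA) :
    Layout G (update p w (Mark.colour c)) (A.erase w) B F (insert c ΓA) ΓB t where
  cover := by
    have h1 : w ∉ B := Finset.disjoint_left.1 h.disjAB hw
    have h2 : w ∉ F := Finset.disjoint_left.1 h.disjAF hw
    rw [unplayed_update (by simp), h.cover, erase_union_distrib, erase_union_distrib,
      erase_eq_of_notMem h1, erase_eq_of_notMem h2]
  disjAB := h.disjAB.mono_left (erase_subset _ _)
  disjAF := h.disjAF.mono_left (erase_subset _ _)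
  disjBF := h.disjBF
  indepA u hu v hv := h.indepA u (mem_of_mem_erase hu) v (mem_of_mem_erase hv)
  indepB := h.indepB
  safeA v hv d hd := by
    have hv' := mem_of_mem_erase hv
    rw [seen_update_of_not_adj (h.memA hw) (h.indepA v hv' w hw)]
    rcases mem_insert.1 hd with rfl | hd
    · exact hc.elim notMem_seen_of_unused (h.safeA v hv' d)
    · exact h.safeA v hv' d hd
  safeB v hv d hd := by
    rw [mem_seen_update (h.memA hw)]
    rintro (h' | ⟨-, h'⟩)
    · exact h.safeB v hv d hd h'
    · simp only [Mark.colour.injEq] at h'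
      exact h.notMemB hc (h' ▸ hd)
  usedA := Finset.disjoint_left.2 fun d hd hd' => by
    rw [mem_unused_update (h.memA hw)] at hd'
    rcases mem_insert.1 hd with rfl | hd
    · exact hd'.2 rfl
    · exact Finset.disjoint_left.1 h.usedA hd hd'.1
  usedB := Finset.disjoint_left.2 fun d hd hd' =>
    Finset.disjoint_left.1 h.usedB hd ((mem_unused_update (h.memA hw)).1 hd').1
  disjΓ := by
    rw [disjoint_insert_left]
    exact ⟨h.notMemB hc, h.disjΓ⟩
  neA _ := insert_nonempty _ _
  neB := h.neB
  col := h.col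

/-- A move of Maker in `A` in a safe colour. -/
lemma play_left (h : Layout G p A B F ΓA ΓB t) (hw : w ∈ A) (hc : c ∈ ΓA) :
    Layout G (update p w (Mark.colour c)) (A.erase w) B F ΓA ΓB t := by
  simpa [hc] using h.colour_left hw (Or.inr hc)

/-- A layout extends to a plan which uses new colours on `F`. -/
lemma exists_plan (h : Layout G p A B F ΓA ΓB t) (ht : t ≤ #(unused p))
    (hne : (unplayed p).Nonempty) :
    ∃ f Z, Plan G p f Z ∧ #(unused p) ≤ #Z + t ∧ ∀ v ∈ F, f v ∈ unused p := by
  obtain ⟨g, hg, hgc⟩ := h.col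
  obtain ⟨e, he⟩ := Function.Embedding.exists_of_card_le_finset
    (α := ↥(F.image g)) (s := unused p) (by simpa using hgc.trans ht)
  have he' : ∀ y, e y ∈ unused p := fun y => he ⟨y, rfl⟩
  -- The colours `a` and `b` must exist even if `A` or `B` is empty; any colour then serves as
  -- default, and `hne` guarantees that there is one.
  have hA : ∃ a : Fin k, A.Nonempty → a ∈ ΓA := by
    by_cases hA : A.Nonempty
    · obtain ⟨a, ha⟩ := h.neA hA
      exact ⟨a, fun _ => ha⟩
    by_cases hB : B.Nonempty
    · obtain ⟨a, ha⟩ := h.neB hB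
      exact ⟨a, fun h' => (hA h').elim⟩
    obtain ⟨v, hv⟩ := hne
    rcases h.mem_cases hv with hv | hv | hv
    · exact (hA ⟨v, hv⟩).elim
    · exact (hB ⟨v, hv⟩).elim
    · exact ⟨e ⟨g v, mem_image_of_mem g hv⟩, fun h' => (hA h').elim⟩
  obtain ⟨a, ha⟩ := hA
  have hB : ∃ b : Fin k, B.Nonempty → b ∈ ΓB := by
    by_cases hB : B.Nonempty
    · obtain ⟨b, hb⟩ := h.neB hB
      exact ⟨b, fun _ => hb⟩
    · exact ⟨a, fun h' => (hB h').elim⟩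
  obtain ⟨b, hb⟩ := hB
  let f : V → Fin k := fun v =>
    if hv : v ∈ F then e ⟨g v, mem_image_of_mem g hv⟩ else if v ∈ A then a else b
  have fF : ∀ v (hv : v ∈ F), f v = e ⟨g v, mem_image_of_mem g hv⟩ := fun v hv => by simp [f, hv]
  have fA : ∀ v ∈ A, f v = a := fun v hv => by
    simp [f, hv, Finset.disjoint_left.1 h.disjAF hv]
  have fB : ∀ v ∈ B, f v = b := fun v hv => by
    simp [f, Finset.disjoint_left.1 h.disjBF hv, Finset.disjoint_right.1 h.disjAB hv]
  have aU : A.Nonempty → a ∉ unused p := fun h' => Finset.disjoint_left.1 h.usedA (ha h')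
  have bU : B.Nonempty → b ∉ unused p := fun h' => Finset.disjoint_left.1 h.usedB (hb h')
  refine ⟨f, unused p \ univ.map e, ⟨?_, ?_, ?_, sdiff_subset⟩, ?_, ?_⟩
  · intro v hv
    rcases h.mem_cases hv with hv | hv | hv
    · rw [fA v hv]; exact h.safeA v hv a (ha ⟨v, hv⟩)
    · rw [fB v hv]; exact h.safeB v hv b (hb ⟨v, hv⟩)
    · rw [fF v hv]; exact notMem_seen_of_unused (he' _)
  · intro u hu v hv huv
    rcases h.mem_cases hu with hu | hu | hu <;> rcases h.mem_cases hv with hv | hv | hv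
    · exact (h.indepA u hu v hv huv).elim
    · rw [fA u hu, fB v hv]
      rintro rfl
      exact Finset.disjoint_left.1 h.disjΓ (ha ⟨u, hu⟩) (hb ⟨v, hv⟩)
    · rw [fA u hu, fF v hv]
      intro h'
      exact aU ⟨u, hu⟩ (h' ▸ he' _)
    · rw [fB u hu, fA v hv]
      rintro rfl
      exact Finset.disjoint_left.1 h.disjΓ (ha ⟨v, hv⟩) (hb ⟨u, hu⟩)
    · exact (h.indepB u hu v hv huv).elim
    · rw [fB u hu, fF v hv]
      intro h'
      exact bU ⟨u, hu⟩ (h' ▸ he' _)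
    · rw [fF u hu, fA v hv]
      intro h'
      exact aU ⟨v, hv⟩ (h' ▸ he' _)
    · rw [fF u hu, fB v hv]
      intro h'
      exact bU ⟨v, hv⟩ (h' ▸ he' _)
    · rw [fF u hu, fF v hv]
      intro h'
      have := e.injective h'
      simp only [Subtype.mk.injEq] at this
      exact hg u hu v hv huv this
  · intro v hv
    rcases h.mem_cases hv with hv | hv | hv
    · rw [fA v hv]; simp [aU ⟨v, hv⟩]
    · rw [fB v hv]; simp [bU ⟨v, hv⟩]
    · rw [fF v hv]; simp
  · have h1 := le_card_sdiff (univ.map e) (unused p)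
    rw [card_map, card_univ, Fintype.card_coe] at h1
    omega
  · intro v hv
    rw [fF v hv]
    exact he' _

/-- Maker wins if he has a new colour in reserve for every move of Breaker but the last one. -/
lemma mWin_of_reserve (h : Layout G p A B F ΓA ΓB t) {d : ℕ} (hU : t + d ≤ #(unused p))
    (hm : #(unplayed p) ≤ 2 * d + 2) : MWin G p := by
  rcases (unplayed p).eq_empty_or_nonempty with h0 | hne
  · exact finished_of_unplayed_eq_empty h0
  obtain ⟨f, Z, hP, hZ, -⟩ := h.exists_plan (by omega) hne
  exact hP.mWin (by omega)

/-- A new colour on `F` does not cost Maker anything. -/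
lemma mWin_of_new (h : Layout G p A B F ΓA ΓB t) {d : ℕ} (hU : t + d ≤ #(unused p))
    (hm : #(unplayed p) ≤ 2 * d + 3) (hw : w ∈ F) (hc : c ∈ unused p) :
    MWin G (update p w (Mark.colour c)) := by
  obtain ⟨f, Z, hP, hZ, hF⟩ := h.exists_plan (by omega) ⟨w, h.memF hw⟩
  obtain ⟨f', Z', hP', hZ'⟩ := hP.exists_colour_new (h.memF hw) (hF w hw) hc
  have hr := (isReply_colour (h.memF hw) (notMem_seen_of_unused (G := G) hc)).card
  exact hP'.mWin (by omega)

lemma exists_live (h : Layout G p A B F ΓA ΓB t) (hU : t ≤ #(unused p))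
    (hne : (unplayed p).Nonempty) : ∃ v ∈ unplayed p, ∃ c, c ∉ seen G p v := by
  obtain ⟨f, Z, hP, -, -⟩ := h.exists_plan hU hne
  obtain ⟨v, hv⟩ := hne
  exact ⟨v, hv, f v, hP.legal v hv⟩

end Layout

/-! ### Odd positions with one colour missing -/

/-- Maker wins at his turn in positions with at most `n` unplayed vertices, an odd number,
provided that he lacks at most one colour of having one in reserve for every move of Breaker. -/
def OddWin (G : SimpleGraph V) (k n : ℕ) : Prop :=
  ∀ (p : V → Mark k) (b t : ℕ), #(unplayed p) = 2 * b + 1 → #(unplayed p) ≤ n → 1 ≤ b →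
    Col G (unplayed p) t → t + b ≤ #(unused p) + 1 → MWin G p

namespace Layout

/-- A safe vertex lets Maker pass: a safe colour there spends no new colour and leaves `F` alone.
Without safe vertices `F` is the whole board and `OddWin` applies. -/
lemma mWin_of_bWin {n b : ℕ} (hO : OddWin G k n) (h : Layout G p A B F ΓA ΓB t)
    (hb : #(unplayed p) = 2 * b + 1) (hn : #(unplayed p) ≤ n) (hF : 2 ≤ #F)
    (hU : t + b ≤ #(unused p) + 1)
    (ih : ∀ (p : V → Mark k) (A B F : Finset V) (ΓA ΓB : Finset (Fin k)) (t : ℕ),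
      Layout G p A B F ΓA ΓB t → #(unplayed p) = 2 * b → 2 ≤ #F → t + b ≤ #(unused p) + 1 →
      BWin G p) : MWin G p := by
  have key : ∀ {A B : Finset V} {ΓA ΓB : Finset (Fin k)}, Layout G p A B F ΓA ΓB t →
      A.Nonempty → MWin G p := by
    intro A B ΓA ΓB h hA
    obtain ⟨c, hc⟩ := h.neA hA
    obtain ⟨z, hz⟩ := hA
    have hs := h.safeA z hz c hc
    refine mWin_of_move (h.memA hz) hs (ih _ _ _ _ _ _ _ (h.play_left hz hc) ?_ hF ?_)
    · have := (isReply_colour (h.memA hz) hs).card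
      omega
    · rwa [unused_update_of_notMem (h.memA hz) (Finset.disjoint_left.1 h.usedA hc)]
  rcases A.eq_empty_or_nonempty with rfl | hA
  · rcases B.eq_empty_or_nonempty with rfl | hB
    · have hF' : unplayed p = F := by simp [h.cover]
      refine hO p b t hb hn ?_ ?_ hU
      · rw [hF'] at hb; omega
      · rw [hF']; exact h.col
    · exact key h.symm hB
  · exact key h hA

/-- The balance is one short of a full reserve. Each harmful reply lowers `b` by one and either
spends one unused colour or raises `t` by one, so the balance is kept; any other reply leaves a full
reserve. The deficit cannot last, since `2 ≤ #F` excludes `b = 0`. -/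
lemma bWin_of_oddWin {n b : ℕ} (hO : OddWin G k n) (h : Layout G p A B F ΓA ΓB t)
    (hb : #(unplayed p) = 2 * b) (hn : #(unplayed p) ≤ n + 1) (hF : 2 ≤ #F)
    (hU : t + b ≤ #(unused p) + 1) : BWin G p := by
  induction b generalizing p A B F ΓA ΓB t with
  | zero => have := h.card_eq; omega
  | succ b ih =>
  have hFne : F.Nonempty := card_pos.1 (by omega)
  have ht := h.pos hFne
  refine bWin_of_reply (h.exists_live (by omega) (hFne.mono fun v hv => h.memF hv))
    fun w x hr => ?_
  have hcard := hr.card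
  have next : ∀ {A B F : Finset V} {ΓA ΓB : Finset (Fin k)} {t : ℕ},
      Layout G (update p w x) A B F ΓA ΓB t → 2 ≤ #F →
      t + b ≤ #(unused (update p w x)) + 1 → MWin G (update p w x) := by
    intro A B F ΓA ΓB t h' hF' hU'
    exact mWin_of_bWin hO h' (by omega) (by omega) hF' hU' fun p A B F ΓA ΓB t h hp hF hU =>
      ih h hp (by omega) hF hU
  -- a safe colour
  have safe : ∀ {A B : Finset V} {ΓA ΓB : Finset (Fin k)}, Layout G p A B F ΓA ΓB t →
      ∀ c ∈ ΓA, x = Mark.colour c → MWin G (update p w x) := by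
    intro A B ΓA ΓB h c hc hx
    have hcU := Finset.disjoint_left.1 h.usedA hc
    have hcB := Finset.disjoint_left.1 h.disjΓ hc
    have hU' : #(unused (update p w x)) = #(unused p) := by
      rw [hx, unused_update_of_notMem hr.1 hcU]
    have hxB : ∀ d ∈ ΓB, x ≠ Mark.colour d := by
      rintro d hd h'
      rw [hx, Mark.colour.injEq] at h'
      exact hcB (h' ▸ hd)
    -- Only the loss of the last safe colour matters. Then `A` joins `F`, which makes up for a
    -- vertex of `F` that may just have been played.
    by_cases hsingle : A.Nonempty ∧ ΓA.erase c = ∅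
    · have h' := h.demote.reply hr (by simp) hxB
      refine next h' ?_ (by omega)
      have hA := card_pos.2 hsingle.1
      have hd := card_union_of_disjoint h.disjAF
      have := pred_card_le_card_erase (s := A ∪ F) (a := w)
      omega
    · have h1 : Layout G p A B F (ΓA.erase c) ΓB t := by
        refine h.shrink (erase_subset _ _) fun hA => ?_
        rw [nonempty_iff_ne_empty]
        exact fun h' => hsingle ⟨hA, h'⟩
      have h2 := h1.reply hr (by
        rintro d hd h'
        rw [hx, Mark.colour.injEq] at h'
        exact ne_of_mem_erase hd h'.symm) hxB
      exact h2.mWin_of_reserve (d := b) (by omega) (by omega)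
  -- a new colour on a safe vertex
  have new : ∀ {A B : Finset V} {ΓA ΓB : Finset (Fin k)}, Layout G p A B F ΓA ΓB t → w ∈ A →
      ∀ c ∈ unused p, x = Mark.colour c → MWin G (update p w x) := by
    intro A B ΓA ΓB h hw c hc hx
    have h1 := h.colour_left hw (Or.inl hc)
    have h2 := card_unused_update_of_mem (h.memA hw) hc
    rw [← hx] at h1 h2
    exact next h1 hF (by omega)
  by_cases hA : ∃ c ∈ ΓA, x = Mark.colour c
  · obtain ⟨c, hc, hx⟩ := hA
    exact safe h c hc hx
  by_cases hB : ∃ c ∈ ΓB, x = Mark.colour c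
  · obtain ⟨c, hc, hx⟩ := hB
    exact safe h.symm c hc hx
  push Not at hA hB
  by_cases hN : ∃ c ∈ unused p, x = Mark.colour c
  · obtain ⟨c, hc, hx⟩ := hN
    rcases h.mem_cases hr.1 with hw | hw | hw
    · exact new h hw c hc hx
    · exact new h.symm hw c hc hx
    · rw [hx]
      exact h.mWin_of_new (d := b) (by omega) (by omega) hw hc
  · have hU' : #(unused (update p w x)) = #(unused p) := by
      congr 1
      ext c
      rw [mem_unused_update hr.1, and_iff_left_iff_imp]
      exact fun hc hx => hN ⟨c, hc, hx⟩
    exact (h.reply hr hA hB).mWin_of_reserve (d := b) (by omega) (by omega)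

end Layout

/-- The standard opening: the class of `v` is independent, so its other vertices do not see the new
colour, and the remaining classes number one less. -/
lemma singleton_layout (hv : v ∈ unplayed p) (hc : c ∈ unused p) (hg : ProperOn G (unplayed p) g)
    (ht : #((unplayed p).image g) ≤ t) :
    Layout G (update p v (Mark.colour c)) ({u ∈ unplayed p | g u = g v}.erase v) ∅
      {u ∈ unplayed p | g u ≠ g v} {c} ∅ (t - 1) where
  cover := by
    rw [unplayed_update (by simp)]
    ext u
    by_cases h : g u = g v <;> by_cases h' : u = v <;> simp_all
  disjAB := by simp
  disjAF := by
    rw [Finset.disjoint_left]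
    intro u hu
    simp only [mem_erase, mem_filter] at hu
    simp [hu]
  disjBF := by simp
  indepA u hu w hw h := by
    simp only [mem_erase, mem_filter] at hu hw
    exact hg u hu.2.1 w hw.2.1 h (hu.2.2.trans hw.2.2.symm)
  indepB := by simp
  safeA u hu d hd := by
    simp only [mem_erase, mem_filter] at hu
    rw [mem_singleton] at hd
    subst hd
    rw [seen_update_of_not_adj hv fun h => hg u hu.2.1 v hv h hu.2.2]
    exact notMem_seen_of_unused hc
  safeB := by simp
  usedA := by
    rw [disjoint_singleton_left, mem_unused_update hv]
    simp
  usedB := by simp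
  disjΓ := by simp
  neA := by simp
  neB := by simp
  col := hg.col_filter_ne hv ht

/-- The opening lowers both `t` and the number of unused colours by one, so the balance is kept. It
only has to leave two vertices outside the class played. -/
lemma oddWin (G : SimpleGraph V) (k n : ℕ) : OddWin G k n := by
  induction n with
  | zero => intro p b t hb hn; omega
  | succ n ih =>
  intro p b t hb hn hb1 hcol hU
  obtain ⟨g, hg, hgt⟩ := hcol
  have hne : (unplayed p).Nonempty := card_pos.1 (by omega)
  have ht : 1 ≤ t := (card_pos.2 (hne.image g)).trans_le hgt
  have main : ∀ v ∈ unplayed p, 2 ≤ #{u ∈ unplayed p | g u ≠ g v} → MWin G p := by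
    intro v hv h2
    obtain ⟨c, hc⟩ := card_pos.1 (by omega : 0 < #(unused p))
    have hL := singleton_layout hv hc hg hgt
    have h1 := card_unused_update_of_mem hv hc
    have h3 := (isReply_colour hv (notMem_seen_of_unused (G := G) hc)).card
    exact mWin_of_move hv (notMem_seen_of_unused hc)
      (hL.bWin_of_oddWin ih (b := b) (by omega) (by omega) h2 (by omega))
  obtain ⟨v, hv⟩ := hne
  by_cases h2 : 2 ≤ #{u ∈ unplayed p | g u ≠ g v}
  · exact main v hv h2
  rcases Nat.eq_zero_or_pos #{u ∈ unplayed p | g u ≠ g v} with h0 | h1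
  · rw [card_eq_zero, filter_eq_empty_iff] at h0
    simp only [not_not] at h0
    refine win_of_indep_of_unused _ (fun u hu w hw h => ?_) (by omega)
    exact hg u hu w hw h ((h0 hu).trans (h0 hw).symm)
  -- Just one vertex `u` lies outside the class of `v`; opening at `u` leaves that whole class, at
  -- least two vertices, in `F`.
  · obtain ⟨u, hu⟩ := card_pos.1 h1
    rw [mem_filter] at hu
    refine main u hu.1 ?_
    have hsub : {w ∈ unplayed p | g w = g v} ⊆ {w ∈ unplayed p | g w ≠ g u} := by
      intro w hw
      rw [mem_filter] at hw ⊢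
      exact ⟨hw.1, fun h => hu.2 (h.symm.trans hw.2)⟩
    have h3 := card_le_card hsub
    have h4 := card_filter_add_card_filter_not (s := unplayed p) (fun w => g w = g v)
    simp only [← ne_eq] at h4
    omega

namespace Layout

lemma bWin_even {b : ℕ} (h : Layout G p A B F ΓA ΓB t) (hb : #(unplayed p) = 2 * b)
    (hF : 2 ≤ #F) (hU : t + b ≤ #(unused p) + 1) : BWin G p :=
  h.bWin_of_oddWin (oddWin G k _) hb (Nat.le_succ _) hF hU

lemma mWin_odd {b : ℕ} (h : Layout G p A B F ΓA ΓB t) (hb : #(unplayed p) = 2 * b + 1)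
    (hF : 2 ≤ #F) (hU : t + b ≤ #(unused p) + 1) : MWin G p :=
  mWin_of_bWin (oddWin G k _) h hb le_rfl hF hU fun _ _ _ _ _ _ _ h hb hF hU =>
    h.bWin_even hb hF hU

end Layout

/-! ### Making Breaker waste moves -/

namespace Layout

variable {Γ : Finset (Fin k)}

/-- One move of Breaker in a position with only one safe set. -/
lemma bWin_of_step (h : Layout G p A ∅ F Γ ∅ t) (ht : t ≤ #(unused p))
    (hne : (unplayed p).Nonempty)
    (hsave : ∀ w x, IsReply G p w x → ∀ A' Γ', Layout G (update p w x) A' ∅ (F.erase w) Γ' ∅ t →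
      #(unused (update p w x)) = #(unused p) → MWin G (update p w x))
    (hF : ∀ w ∈ F, ∀ c ∈ unused p, MWin G (update p w (Mark.colour c)))
    (hA : ∀ w ∈ A, ∀ c ∈ unused p, MWin G (update p w (Mark.colour c)))
    (hkill : ∀ c, Γ = {c} → A.Nonempty → ∀ w ∈ F, c ∉ seen G p w →
      MWin G (update p w (Mark.colour c))) : BWin G p := by
  refine bWin_of_reply (h.exists_live ht hne) fun w x hr => ?_
  by_cases hN : ∃ c ∈ unused p, x = Mark.colour c
  · obtain ⟨c, hc, rfl⟩ := hN
    rcases h.mem_cases hr.1 with hw | hw | hw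
    · exact hA w hw c hc
    · simp at hw
    · exact hF w hw c hc
  have hU' : #(unused (update p w x)) = #(unused p) := by
    congr 1
    ext c
    rw [mem_unused_update hr.1, and_iff_left_iff_imp]
    exact fun hc hx => hN ⟨c, hc, hx⟩
  by_cases hΓ : ∃ c ∈ Γ, x = Mark.colour c
  · obtain ⟨c, hc, rfl⟩ := hΓ
    by_cases hw : w ∈ A
    · have h' := h.play_left hw hc
      rw [← erase_eq_of_notMem (Finset.disjoint_left.1 h.disjAF hw)] at h'
      exact hsave _ _ hr _ _ h' hU'
    have hwF : w ∈ F := by simpa [hw] using h.mem_cases hr.1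
    by_cases hs : A.Nonempty ∧ Γ.erase c = ∅
    · have hΓc : Γ = {c} := by
        rw [← insert_erase hc, hs.2, insert_empty_eq]
      rcases hr.2 with h' | ⟨d, hd, h'⟩
      · simp at h'
      · rw [Mark.colour.injEq] at h'
        exact hkill c hΓc hs.1 w hwF (h' ▸ hd)
    · have h1 : Layout G p A ∅ F (Γ.erase c) ∅ t := by
        refine h.shrink (erase_subset _ _) fun hA => ?_
        rw [nonempty_iff_ne_empty]
        exact fun h' => hs ⟨hA, h'⟩
      refine hsave _ _ hr _ _ (h1.reply hr ?_ (by simp)) hU'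
      rintro d hd h'
      rw [Mark.colour.injEq] at h'
      exact ne_of_mem_erase hd h'.symm
  · push Not at hΓ
    exact hsave _ _ hr _ _ (h.reply hr hΓ (by simp)) hU'

/-- The position after Breaker has played a new colour in `A` and Maker has answered in `A`. -/
lemma exists_answer (h : Layout G p A ∅ F Γ ∅ t) (hw : w ∈ A) (hc : c ∈ unused p)
    (hA : (A.erase w).Nonempty) :
    ∃ q : V → Mark k, ∃ A' Γ', Layout G q A' ∅ F Γ' ∅ t ∧ #A' + 2 = #A ∧
      #(unplayed q) + 2 = #(unplayed p) ∧ #(unused q) + 1 = #(unused p) ∧ 2 ≤ #Γ' ∧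
      (BWin G q → MWin G (update p w (Mark.colour c))) := by
  have h1 := h.colour_left hw (Or.inl hc)
  obtain ⟨z, hz⟩ := hA
  have hcΓ : c ∈ insert c Γ := mem_insert_self _ _
  have h2 := h1.play_left hz hcΓ
  have hs := h1.safeA z hz c hcΓ
  refine ⟨_, _, _, h2, ?_, ?_, ?_, ?_, fun hB => mWin_of_move (h1.memA hz) hs hB⟩
  · have := card_erase_add_one hz
    have := card_erase_add_one hw
    omega
  · have := (isReply_colour (h1.memA hz) hs).card
    have := (isReply_colour (h.memA hw) (notMem_seen_of_unused (G := G) hc)).card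
    omega
  · rw [unused_update_of_notMem (h1.memA hz) (Finset.disjoint_left.1 h1.usedA hcΓ),
      card_unused_update_of_mem (h.memA hw) hc]
  -- The set `A` had a safe colour already and `c` is new, so there are now two.
  · have h3 := card_pos.2 (h.neA ⟨w, hw⟩)
    rw [card_insert_of_notMem fun h' => Finset.disjoint_left.1 h.usedA h' hc]
    omega

/-- Maker needs Breaker to waste one move, and makes him do so by filling up `A`. -/
lemma bWin_of_one_save {b : ℕ} (h : Layout G p A ∅ F Γ ∅ t) (hb : #(unplayed p) = 2 * b + 1)
    (hF : 2 ≤ #F) (hU : t + b ≤ #(unused p) + 1)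
    (hend : Odd #A → ∀ q : V → Mark k, unplayed q = F → t + #F / 2 ≤ #(unused q) + 2 → MWin G q)
    (hkill : ∀ c, Γ = {c} → A.Nonempty → ∀ w ∈ F, c ∉ seen G p w →
      MWin G (update p w (Mark.colour c))) : BWin G p := by
  induction b generalizing p A Γ with
  | zero => have := h.card_eq; omega
  | succ b ih =>
  have hFne : F.Nonempty := card_pos.1 (by omega)
  refine h.bWin_of_step (by omega) (card_pos.1 (by omega)) ?_ ?_ ?_ hkill
  · intro w x hr A' Γ' h' hU'
    have := hr.card
    exact h'.mWin_of_reserve (d := b) (by omega) (by omega)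
  · intro w hw c hc
    exact h.mWin_of_new (d := b) (by omega) (by omega) hw hc
  · intro w hw c hc
    -- Moves in `A` come in pairs, so Breaker can take the last vertex of `A` only if `#A` was odd;
    -- Maker then moves on `F` alone.
    rcases (A.erase w).eq_empty_or_nonempty with hA | hA
    · have hA1 : #A = 1 := by
        have := card_erase_add_one hw
        rw [hA, card_empty] at this
        exact this.symm
      have h1 := h.colour_left hw (Or.inl hc)
      rw [hA] at h1
      have h2 := card_unused_update_of_mem (h.memA hw) hc
      have h3 := h.card_eq
      rw [card_empty] at h3
      refine hend (by rw [hA1]; exact odd_one) _ (by simp [h1.cover]) (by omega)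
    · obtain ⟨q, A', Γ', h', hA', hq, hqU, hΓ', hwin⟩ := h.exists_answer hw hc hA
      refine hwin (ih h' (by omega) (by omega) (fun ho => hend ?_) ?_)
      · rw [← hA']; exact ho.add_even even_two
      -- With two safe colours, the attack on a single one does not recur.
      · intro d hd
        rw [hd, card_singleton] at hΓ'
        omega

/-- The class of `w` becomes safe when a new colour is played at `w`. -/
lemma new_class (h : Layout G p A ∅ F Γ ∅ s) (hg : ProperOn G F g) (ht : #(F.image g) ≤ t)
    (hw : w ∈ F) (hc : c ∈ unused p) :
    Layout G (update p w (Mark.colour c)) A ({u ∈ F | g u = g w}.erase w) {u ∈ F | g u ≠ g w}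
      Γ {c} (t - 1) where
  cover := by
    have h1 : w ∉ A := Finset.disjoint_right.1 h.disjAF hw
    rw [unplayed_update (by simp), h.cover]
    ext u
    by_cases h2 : g u = g w <;> by_cases h3 : u = w <;> simp_all
  disjAB := h.disjAF.mono_right ((erase_subset _ _).trans (filter_subset _ _))
  disjAF := h.disjAF.mono_right (filter_subset _ _)
  disjBF := by
    rw [Finset.disjoint_left]
    intro u hu
    simp only [mem_erase, mem_filter] at hu
    simp [hu]
  indepA := h.indepA
  indepB u hu v hv huv := by
    simp only [mem_erase, mem_filter] at hu hv
    exact hg u hu.2.1 v hv.2.1 huv (hu.2.2.trans hv.2.2.symm)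
  safeA v hv d hd := by
    rw [mem_seen_update (h.memF hw)]
    rintro (h' | ⟨-, h'⟩)
    · exact h.safeA v hv d hd h'
    · rw [Mark.colour.injEq] at h'
      exact Finset.disjoint_left.1 h.usedA hd (h' ▸ hc)
  safeB u hu d hd := by
    simp only [mem_erase, mem_filter] at hu
    rw [mem_singleton] at hd
    subst hd
    rw [seen_update_of_not_adj (h.memF hw) fun h => hg u hu.2.1 w hw h hu.2.2]
    exact notMem_seen_of_unused hc
  usedA := Finset.disjoint_left.2 fun d hd hd' =>
    Finset.disjoint_left.1 h.usedA hd ((mem_unused_update (h.memF hw)).1 hd').1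
  usedB := by
    rw [disjoint_singleton_left, mem_unused_update (h.memF hw)]
    simp
  disjΓ := by
    rw [disjoint_singleton_right]
    exact fun h' => Finset.disjoint_left.1 h.usedA h' hc
  neA := h.neA
  neB := by simp
  col := hg.col_filter_ne hw ht

/-- Maker needs Breaker to waste two moves. -/
lemma bWin_of_two_saves {b : ℕ} (h : Layout G p A ∅ F Γ ∅ t) (hb : #(unplayed p) = 2 * b)
    (hA : Even #A) (hF : 4 ≤ #F) (hU : t + b ≤ #(unused p) + 2)
    (hg : ProperOn G F g) (ht : #(F.image g) ≤ t)
    (hgF : A.Nonempty → ∀ w ∈ F, 2 ≤ #{u ∈ F | g u ≠ g w})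
    (hkill : ∀ c, Γ = {c} → A.Nonempty → ∀ w ∈ F, c ∉ seen G p w →
      MWin G (update p w (Mark.colour c))) : BWin G p := by
  induction b generalizing p A Γ with
  | zero => have := h.card_eq; omega
  | succ b ih =>
  have hFne : F.Nonempty := card_pos.1 (by omega)
  have ht1 := h.pos hFne
  have hcard := h.card_eq
  rw [card_empty] at hcard
  refine h.bWin_of_step (by omega) (card_pos.1 (by omega)) ?_ ?_ ?_ hkill
  -- After a first wasted move only one colour is missing, and `mWin_odd` supplies the second waste.
  · intro w x hr A' Γ' h' hU'
    have := hr.card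
    have := pred_card_le_card_erase (s := F) (a := w)
    exact h'.mWin_odd (b := b) (by omega) (by omega) (by omega)
  -- A new colour on `F` is a wasted move too: the class of `w` becomes a second safe set, and `t`
  -- drops together with the unused colours.
  · intro w hw c hc
    have h1 := h.new_class hg ht hw hc
    have h2 := card_unused_update_of_mem (h.memF hw) hc
    have h3 := (isReply_colour (h.memF hw) (notMem_seen_of_unused (G := G) hc)).card
    by_cases h4 : 2 ≤ #{u ∈ F | g u ≠ g w}
    · exact h1.mWin_odd (b := b) (by omega) h4 (by omega)
    -- If at most one vertex is left outside the class of `w`, then `A` is empty by `hgF`. Maker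
    -- colours that vertex in a new colour, and `c` suits the rest.
    rcases A.eq_empty_or_nonempty with rfl | hAne
    swap
    · exact (h4 (hgF hAne w hw)).elim
    rcases Nat.eq_zero_or_pos #{u ∈ F | g u ≠ g w} with h5 | h5
    · rw [card_eq_zero] at h5
      rw [h5] at h1
      have hcov := h1.cover
      simp only [empty_union, union_empty] at hcov
      refine win_of_indep (c := c) _ (fun u hu v hv => ?_) fun v hv => ?_
      · exact h1.indepB u (hcov ▸ hu) v (hcov ▸ hv)
      · exact h1.safeB v (hcov ▸ hv) c (mem_singleton_self c)
    · obtain ⟨u, hu⟩ := card_pos.1 h5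
      have ht2 := h1.pos ⟨u, hu⟩
      obtain ⟨d, hd⟩ := card_pos.1 (by omega : 0 < #(unused (update p w (Mark.colour c))))
      refine mWin_of_move (h1.memF hu) (notMem_seen_of_unused hd) ?_
      have h6 := h1.reply (isReply_colour (h1.memF hu) (notMem_seen_of_unused hd)) (by
        intro e he h'
        rw [Mark.colour.injEq] at h'
        exact Finset.disjoint_left.1 h1.usedA he (h' ▸ hd)) (by
        intro e he h'
        rw [Mark.colour.injEq] at h'
        exact Finset.disjoint_left.1 h1.usedB he (h' ▸ hd))
      have h7 : ({u ∈ F | g u ≠ g w} : Finset V).erase u = ∅ := by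
        have := card_erase_add_one hu
        exact card_eq_zero.1 (by omega)
      have hcov := h6.cover
      rw [h7] at hcov
      simp only [erase_empty, empty_union, union_empty] at hcov
      refine win_of_indep (c := c) _ (fun u hu v hv => ?_) fun v hv => ?_
      · exact h6.indepB u (hcov ▸ hu) v (hcov ▸ hv)
      · exact h6.safeB v (hcov ▸ hv) c (mem_singleton_self c)
  · intro w hw c hc
    have h1 := card_erase_add_one hw
    -- Since `#A` is even, Maker can always answer in `A`.
    have hAne : (A.erase w).Nonempty := by
      rw [← card_pos]
      rcases hA with ⟨a, ha⟩
      omega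
    obtain ⟨q, A', Γ', h', hA', hq, hqU, hΓ', hwin⟩ := h.exists_answer hw hc hAne
    refine hwin (ih h' (by omega) ?_ (by omega) (fun _ => hgF ⟨w, hw⟩) ?_)
    · rw [← hA', Nat.even_add] at hA
      exact hA.2 even_two
    · intro d hd
      rw [hd, card_singleton] at hΓ'
      omega

end Layout

/-- Maker wins if there are only two vertices which could run out of colours. -/
lemma mWin_of_two (hU : 3 ≤ #(unused p)) {r₁ r₂ : V} (hr : r₁ ∈ unplayed p)
    (h : ∀ v ∈ unplayed p, v ≠ r₁ → v ≠ r₂ → #(freeNbrs G p v) < #(unused p)) : MWin G p := by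
  obtain ⟨c, hc⟩ := card_pos.1 (by omega : 0 < #(unused p))
  have hc' : c ∉ seen G p r₁ := notMem_seen_of_unused hc
  -- Before Maker returns, `r₂` sees at most two further colours, and three are unused.
  refine mWin_of_move hr hc' ?_
  have hr1 := isReply_colour hr hc'
  have hk := card_seen_add_card_unused_le (G := G) (p := p) (v := r₂)
  have hk1 := card_seen_update_le (v := r₂) hr1
  have sec : ∀ v ∈ unplayed (update p r₁ (Mark.colour c)), v ≠ r₂ →
      Secure G (update p r₁ (Mark.colour c)) v := by
    intro v hv hv2
    rw [hr1.unplayed_eq, mem_erase] at hv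
    exact (secure_of_card_lt (h v hv.2 hv.1 hv2)).update hr1
  rcases (unplayed (update p r₁ (Mark.colour c))).eq_empty_or_nonempty with h0 | ⟨v, hv⟩
  · exact finished_of_unplayed_eq_empty h0
  refine bWin_of_reply ⟨v, hv, ?_⟩ fun w x hr2 => ?_
  · by_cases hv2 : v = r₂
    · subst hv2
      exact exists_notMem_seen (by omega)
    · exact (sec v hv hv2).exists_legal
  have sec2 : ∀ v ∈ unplayed (update (update p r₁ (Mark.colour c)) w x), v ≠ r₂ →
      Secure G (update (update p r₁ (Mark.colour c)) w x) v := by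
    intro v hv hv2
    rw [hr2.unplayed_eq, mem_erase] at hv
    exact (sec v hv.2 hv2).update hr2
  have hk2 := card_seen_update_le (v := r₂) hr2
  by_cases h2 : r₂ ∈ unplayed (update (update p r₁ (Mark.colour c)) w x)
  · obtain ⟨d, hd⟩ := exists_notMem_seen (by omega :
      #(seen G (update (update p r₁ (Mark.colour c)) w x) r₂) < k)
    have hr3 := isReply_colour h2 hd
    refine mWin_of_move h2 hd (win_of_secure _ fun v hv => ?_)
    rw [hr3.unplayed_eq, mem_erase] at hv
    exact (sec2 v hv.2 hv.1).update hr3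
  · exact win_of_secure _ fun v hv => sec2 v hv fun h => h2 (h ▸ hv)

/-! ### Cocktail party graphs -/

/-- `K` induces a complete graph minus a perfect matching. -/
def Cocktail (G : SimpleGraph V) (K : Finset V) : Prop :=
  ∀ v ∈ K, ∃ u ∈ K, u ≠ v ∧ ¬ G.Adj v u ∧ ∀ w ∈ K, w ≠ v → ¬ G.Adj v w → w = u

variable {K : Finset V}

lemma not_cocktail {y z : V} (hx : v ∈ K) (hy : y ∈ K) (hz : z ∈ K) (hyx : y ≠ v) (hzx : z ≠ v)
    (hyz : y ≠ z) (h1 : ¬ G.Adj v y) (h2 : ¬ G.Adj v z) : ¬ Cocktail G K := fun h => by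
  obtain ⟨u, -, -, -, hu⟩ := h v hx
  exact hyz ((hu y hy hyx h1).trans (hu z hz hzx h2).symm)

/-- The pairs of non-neighbours are the colour classes; `e` only encodes them as numbers. -/
lemma Cocktail.col (h : Cocktail G K) : Col G K (#K / 2) := by
  choose! m hm using h
  have hmm : ∀ v ∈ K, m (m v) = v := fun v hv =>
    ((hm (m v) (hm v hv).1).2.2.2 v hv (hm v hv).2.1.symm fun h => (hm v hv).2.2.1 h.symm).symm
  let e : Finset V ≃ Fin (Fintype.card (Finset V)) := Fintype.equivFin _
  have he : ∀ u v : V, (e {u, m u} : ℕ) = e {v, m v} → u = v ∨ u = m v := by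
    intro u v h
    have h' := e.injective (Fin.ext h)
    have : u ∈ ({v, m v} : Finset V) := h' ▸ mem_insert_self u {m u}
    simpa using this
  refine ⟨fun v => e {v, m v}, fun u hu v hv huv h => ?_, ?_⟩
  · rcases he u v h with rfl | rfl
    · exact G.irrefl huv
    · exact (hm v hv).2.2.1 huv.symm
  · rw [Nat.le_div_iff_mul_le two_pos,
      card_eq_sum_card_image (fun v => (e {v, m v} : ℕ)) K, ← smul_eq_mul]
    refine card_nsmul_le_sum _ _ _ fun c hc => ?_
    obtain ⟨v, hv, rfl⟩ := mem_image.1 hc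
    rw [← card_pair (hm v hv).2.1.symm]
    refine card_le_card fun u hu => ?_
    rw [mem_insert, mem_singleton] at hu
    rcases hu with rfl | rfl
    · simp [hv]
    · simp [(hm v hv).1, hmm v hv, pair_comm]

/-- Independent sets in a cocktail party graph have at most two vertices. -/
lemma Cocktail.card_le (h : Cocktail G K) (hT : T ⊆ K) (hg : ProperOn G T g) :
    #T ≤ 2 * #(T.image g) := by
  refine card_le_mul_card_image _ _ fun c hc => ?_
  obtain ⟨v, hv, rfl⟩ := mem_image.1 hc
  obtain ⟨u, hu, huv, -, huniq⟩ := h v (hT hv)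
  refine (card_le_card (t := {v, u}) fun w hw => ?_).trans card_le_two
  rw [mem_filter] at hw
  by_cases hwv : w = v
  · simp [hwv]
  · simp [huniq w (hT hw.1) hwv fun h => hg v hv w hw.1 h hw.2.symm]

/-! ### Even positions with two colours missing -/

/-- Breaker's attack on the colour of the first move. -/
lemma kill_of_first (hv : v ∈ unplayed p) (hc : c ∈ unused p)
    (hkill : (∃ u ∈ unplayed p, u ≠ v ∧ g u = g v) →
      ∀ w ∈ unplayed p, g w ≠ g v → ¬ G.Adj v w → ∀ q : V → Mark k,
      unplayed q = ((unplayed p).erase v).erase w → #(unused p) ≤ #(unused q) + 1 → MWin G q) :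
    ∀ d, ({c} : Finset (Fin k)) = {d} →
      (({u ∈ unplayed p | g u = g v} : Finset V).erase v).Nonempty →
      ∀ w ∈ ({u ∈ unplayed p | g u ≠ g v} : Finset V),
      d ∉ seen G (update p v (Mark.colour c)) w →
      MWin G (update (update p v (Mark.colour c)) w (Mark.colour d)) := by
  have hr := isReply_colour hv (notMem_seen_of_unused (G := G) hc)
  have hUc := card_unused_update_of_mem hv hc
  intro d hd ⟨u, hu⟩ w hw hdw
  obtain rfl : c = d := by simpa using hd
  rw [mem_erase, mem_filter] at hu
  rw [mem_filter] at hw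
  rw [mem_seen_update hv] at hdw
  push Not at hdw
  have hwv : w ≠ v := by rintro rfl; exact hw.2 rfl
  have hw' : w ∈ unplayed (update p v (Mark.colour c)) := by
    rw [hr.unplayed_eq]; exact mem_erase.2 ⟨hwv, hw.1⟩
  refine hkill ⟨u, hu.2.1, hu.1, hu.2.2⟩ w hw.1 hw.2 (fun h => hdw.2 h.symm rfl) _ ?_ ?_
  · rw [unplayed_update (by simp), hr.unplayed_eq]
  · rw [unused_update_of_notMem hw']
    · omega
    · rw [mem_unused_update hv]
      simp

/-- The first move of Maker on an even number of unplayed vertices. -/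
lemma mWin_first {b : ℕ} (hb : #(unplayed p) = 2 * b) (hg : ProperOn G (unplayed p) g)
    (ht : #((unplayed p).image g) ≤ t) (hU : t + b ≤ #(unused p) + 2) (hv : v ∈ unplayed p)
    (hF : 2 ≤ #{u ∈ unplayed p | g u ≠ g v})
    (hend : Even #{u ∈ unplayed p | g u = g v} → ∀ q : V → Mark k,
      unplayed q = {u ∈ unplayed p | g u ≠ g v} →
      t + #{u ∈ unplayed p | g u ≠ g v} / 2 ≤ #(unused q) + 3 → MWin G q)
    (hkill : (∃ u ∈ unplayed p, u ≠ v ∧ g u = g v) →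
      ∀ w ∈ unplayed p, g w ≠ g v → ¬ G.Adj v w → ∀ q : V → Mark k,
      unplayed q = ((unplayed p).erase v).erase w → #(unused p) ≤ #(unused q) + 1 → MWin G q) :
    MWin G p := by
  have hcl := card_filter_add_card_filter_not (s := unplayed p) (fun u => g u = g v)
  simp only [← ne_eq] at hcl
  have hv' : v ∈ ({u ∈ unplayed p | g u = g v} : Finset V) := by simp [hv]
  have hc1 := card_pos.2 ⟨v, hv'⟩
  have ht1 : 1 ≤ t := (card_pos.2 ⟨_, mem_image_of_mem g hv⟩).trans_le ht
  obtain ⟨b, rfl⟩ : ∃ b', b = b' + 1 := ⟨b - 1, by omega⟩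
  obtain ⟨c, hc⟩ := card_pos.1 (by omega : 0 < #(unused p))
  have hcs : c ∉ seen G p v := notMem_seen_of_unused hc
  have hr := isReply_colour hv hcs
  have hrc := hr.card
  have hUc := card_unused_update_of_mem hv hc
  refine mWin_of_move hv hcs ((singleton_layout hv hc hg ht).bWin_of_one_save (b := b)
    (by omega) hF (by omega) ?_ ?_)
  -- Without `v` the class is odd just when it was even with `v`; odd classes thus have no endgame
  -- to worry about.
  · intro ho q hq hqU
    refine hend ?_ q hq (by omega)
    rw [← card_erase_add_one hv']
    exact ho.add_odd odd_one
  · exact kill_of_first hv hc hkill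

/-- Maker wins at his turn in positions with at most `n` unplayed vertices, an even number and at
least six, which do not induce a cocktail party graph, if he lacks at most one colour. -/
def EvenWin (G : SimpleGraph V) (k n : ℕ) : Prop :=
  ∀ (p : V → Mark k) (b t : ℕ), #(unplayed p) = 2 * b → #(unplayed p) ≤ n → 3 ≤ b →
    ¬ Cocktail G (unplayed p) → Col G (unplayed p) t → t + b ≤ #(unused p) + 2 → MWin G p

lemma card_erase_erase (hv : v ∈ S) (hw : w ∈ S) (h : w ≠ v) : #((S.erase v).erase w) + 2 = #S := by
  rw [← card_erase_add_one hv, ← card_erase_add_one (mem_erase.2 ⟨h, hw⟩)]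

/-- The case in which the deletion of two non-adjacent vertices leaves a cocktail party graph. -/
lemma mWin_of_cocktail_erase {b : ℕ} (hE : EvenWin G k (#(unplayed p) - 2))
    (hb : #(unplayed p) = 2 * b) (hb4 : 4 ≤ b) (hg : ProperOn G (unplayed p) g)
    (ht : #((unplayed p).image g) ≤ t) (hU : t + b ≤ #(unused p) + 2) (htb : t + 1 ≤ b)
    (hv : v ∈ unplayed p) (hw : w ∈ unplayed p) (hwv : w ≠ v) (hvw : ¬ G.Adj v w)
    (hK : Cocktail G (((unplayed p).erase v).erase w)) : MWin G p := by
  set K := ((unplayed p).erase v).erase w with hKdef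
  have hKc : #K + 2 = #(unplayed p) := card_erase_erase hv hw hwv
  have hKS : K ⊆ unplayed p := (erase_subset _ _).trans (erase_subset _ _)
  have hS : ∀ u ∈ unplayed p, u = v ∨ u = w ∨ u ∈ K := by
    intro u hu
    by_cases h1 : u = v
    · simp [h1]
    · by_cases h2 : u = w
      · simp [h2]
      · simp [hKdef, h1, h2, hu]
  have hvK : v ∉ K := by simp [hKdef]
  have hwK : w ∉ K := by simp [hKdef]
  -- mates have the same colour
  have mate : ∀ y ∈ K, ∃ y' ∈ K, y' ≠ y ∧ g y' = g y ∧
      ∀ z ∈ K, z ≠ y → ¬ G.Adj y z → z = y' := by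
    intro y hy
    obtain ⟨y', hy', hne, hadj, huniq⟩ := hK y hy
    refine ⟨y', hy', hne, ?_, huniq⟩
    -- Otherwise the `2b - 3` vertices of `K` other than `y` avoid the colour of `y` and lie in at
    -- most `b - 2` classes of size at most two.
    by_contra hgy
    have h1 := hK.card_le (erase_subset y K) (hg.mono ((erase_subset _ _).trans hKS))
    have h2 : (K.erase y).image g ⊆ ((unplayed p).image g).erase (g y) := by
      intro d hd
      obtain ⟨z, hz, rfl⟩ := mem_image.1 hd
      rw [mem_erase] at hz
      refine mem_erase.2 ⟨fun h => ?_, mem_image_of_mem g (hKS hz.2)⟩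
      have := huniq z hz.2 hz.1 fun h' => hg y (hKS hy) z (hKS hz.2) h' h.symm
      exact hgy (this ▸ h)
    have h3 := card_le_card h2
    have h4 := card_erase_add_one (mem_image_of_mem g (hKS hy))
    have h5 := card_erase_add_one hy
    omega
  obtain ⟨x, hx, hxv⟩ : ∃ x ∈ K, g x = g v := by
    -- Likewise, `2b - 2` vertices do not fit into `b - 2` such classes.
    by_contra! hno
    have h1 := hK.card_le subset_rfl (hg.mono hKS)
    have h2 : K.image g ⊆ ((unplayed p).image g).erase (g v) := by
      intro d hd
      obtain ⟨z, hz, rfl⟩ := mem_image.1 hd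
      exact mem_erase.2 ⟨hno z hz, mem_image_of_mem g (hKS hz)⟩
    have h3 := card_le_card h2
    have h4 := card_erase_add_one (mem_image_of_mem g hv)
    omega
  obtain ⟨x', hx', hxx', hgx', hxu⟩ := mate x hx
  have hx'u : ∀ z ∈ K, z ≠ x' → ¬ G.Adj x' z → z = x := by
    obtain ⟨y, hy, -, -, hyu⟩ := mate x' hx'
    have hxy : x = y := hyu x hx hxx'.symm fun h => hg x' (hKS hx') x (hKS hx) h hgx'
    rwa [← hxy] at hyu
  have same : ∀ a ∈ unplayed p, ∀ b ∈ unplayed p, g a = g b → ¬ G.Adj a b :=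
    fun a ha b hb h h' => hg a ha b hb h' h
  -- a vertex `y` of a class of size three which is complete to the rest
  have three : ∀ y y' : V, y ∈ K → y' ∈ K → y' ≠ y → g y = g v → g y' = g v →
      (∀ z ∈ K, z ≠ y → ¬ G.Adj y z → z = y') → G.Adj w y → MWin G p := by
    intro y y' hy hy' hne hgy hgy' hyu hwy
    have hgw : g w ≠ g y := hg w hw y (hKS hy) hwy
    have hcls : ({u ∈ unplayed p | g u = g y} : Finset V) = {v, y, y'} := by
      ext u
      simp only [mem_filter, mem_insert, mem_singleton]
      constructor
      · rintro ⟨hu, hgu⟩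
        rcases hS u hu with rfl | rfl | huK
        · exact Or.inl rfl
        · exact (hgw hgu).elim
        · by_cases huy : u = y
          · exact Or.inr (Or.inl huy)
          · exact Or.inr (Or.inr (hyu u huK huy (same y (hKS hy) u hu hgu.symm)))
      · rintro (rfl | rfl | rfl)
        · exact ⟨hv, hgy.symm⟩
        · exact ⟨hKS hy, rfl⟩
        · exact ⟨hKS hy', hgy'.trans hgy.symm⟩
    have hvy : v ≠ y := by rintro rfl; exact hvK hy
    have hvy' : v ≠ y' := by rintro rfl; exact hvK hy'
    have hcc : #{u ∈ unplayed p | g u = g y} = 3 := by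
      rw [hcls, card_insert_of_notMem (by simp [hvy, hvy']), card_pair hne.symm]
    have hcl := card_filter_add_card_filter_not (s := unplayed p) (fun u => g u = g y)
    simp only [← ne_eq] at hcl
    refine mWin_first hb hg ht hU (hKS hy) (by omega) (fun he => ?_) ?_
    · rw [hcc] at he
      exact absurd he (by decide)
    · rintro - u hu hgu hyu' q -
      rcases hS u hu with rfl | rfl | huK
      · exact (hgu hgy.symm).elim
      · exact (hyu' hwy.symm).elim
      · have huy : u ≠ y := by rintro rfl; exact hgu rfl
        have := hyu u huK huy hyu'
        subst this
        exact (hgu (hgy'.trans hgy.symm)).elim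
  by_cases hwx : G.Adj w x
  · exact three x x' hx hx' hxx' hxv (hgx'.trans hxv) hxu hwx
  by_cases hwx' : G.Adj w x'
  · exact three x' x hx' hx hxx'.symm (hgx'.trans hxv) hxv hx'u hwx'
  -- now `v, w, x, x'` are independent
  have hclass : ∀ u ∈ K, g u = g v → u = x ∨ u = x' := by
    intro u hu hgu
    by_cases hux : u = x
    · exact Or.inl hux
    · exact Or.inr (hxu u hu hux (same x (hKS hx) u (hKS hu) (hxv.trans hgu.symm)))
  have hg'v : ∀ u, u ≠ w → update g w (g v) u = g u := fun u hu => update_of_ne hu _ _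
  have hwadj : ∀ u ∈ unplayed p, u ≠ w → g u = g v → ¬ G.Adj w u := by
    intro u hu huw hgu
    rcases hS u hu with rfl | rfl | huK
    · exact fun h => hvw h.symm
    · exact G.irrefl
    · rcases hclass u huK hgu with rfl | rfl
      · exact hwx
      · exact hwx'
  -- With `w` moved to the class of `v`, every pair of `K` other than `x`, `x'` is a full colour
  -- class in which Maker can open.
  have hg' : ProperOn G (unplayed p) (update g w (g v)) := by
    intro a ha b hb hab
    by_cases haw : a = w
    · subst haw
      have hbw : b ≠ a := hab.ne'
      rw [update_self, hg'v b hbw]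
      exact fun h => hwadj b hb hbw h.symm hab
    · by_cases hbw : b = w
      · subst hbw
        rw [update_self, hg'v a haw]
        exact fun h => hwadj a ha haw h hab.symm
      · rw [hg'v a haw, hg'v b hbw]
        exact hg a ha b hb hab
  have ht' : #((unplayed p).image (update g w (g v))) ≤ t := by
    refine (card_le_card fun d hd => ?_).trans ht
    obtain ⟨z, hz, rfl⟩ := mem_image.1 hd
    by_cases hzw : z = w
    · rw [hzw, update_self]; exact mem_image_of_mem g hv
    · rw [hg'v z hzw]; exact mem_image_of_mem g hz
  obtain ⟨y, hy⟩ : ((K.erase x).erase x').Nonempty := by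
    have := card_erase_erase hx hx' hxx'
    rw [← card_pos]; omega
  simp only [mem_erase] at hy
  obtain ⟨hyx', hyx, hyK⟩ := hy
  obtain ⟨y', hy'K, hyy', hgyy', hyu⟩ := mate y hyK
  have ne_w : ∀ {u}, u ∈ K → u ≠ w := fun hu h => hwK (h ▸ hu)
  have ne_v : ∀ {u}, u ∈ K → u ≠ v := fun hu h => hvK (h ▸ hu)
  have hgyv : g y ≠ g v := fun h => (hclass y hyK h).elim hyx hyx'
  have hcls : ({u ∈ unplayed p | update g w (g v) u = update g w (g v) y} : Finset V) =
      {y, y'} := by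
    ext u
    simp only [mem_filter, mem_insert, mem_singleton]
    rw [hg'v y (ne_w hyK)]
    constructor
    · rintro ⟨hu, hgu⟩
      rcases hS u hu with rfl | rfl | huK
      · rw [hg'v _ hwv.symm] at hgu
        exact (hgyv hgu.symm).elim
      · rw [update_self] at hgu
        exact (hgyv hgu.symm).elim
      · rw [hg'v u (ne_w huK)] at hgu
        by_cases huy : u = y
        · exact Or.inl huy
        · exact Or.inr (hyu u huK huy (same y (hKS hyK) u hu hgu.symm))
    · rintro (rfl | rfl)
      · exact ⟨hKS hyK, hg'v _ (ne_w hyK)⟩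
      · exact ⟨hKS hy'K, by rw [hg'v _ (ne_w hy'K), hgyy']⟩
  have hcc : #{u ∈ unplayed p | update g w (g v) u = update g w (g v) y} = 2 := by
    rw [hcls, card_pair hyy'.symm]
  have hcl := card_filter_add_card_filter_not (s := unplayed p)
    (fun u => update g w (g v) u = update g w (g v) y)
  simp only [← ne_eq] at hcl
  have memF : ∀ u ∈ unplayed p, u ≠ y → u ≠ y' →
      u ∈ ({u ∈ unplayed p | update g w (g v) u ≠ update g w (g v) y} : Finset V) := by
    intro u hu h1 h2
    rw [mem_filter]
    refine ⟨hu, fun h => ?_⟩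
    have : u ∈ ({y, y'} : Finset V) := hcls ▸ mem_filter.2 ⟨hu, h⟩
    simp [h1, h2] at this
  have hxy' : x ≠ y' := by
    rintro rfl
    exact hgyv (hgyy'.symm.trans hxv)
  have hx'y' : x' ≠ y' := by
    rintro rfl
    exact hgyv (hgyy'.symm.trans (hgx'.trans hxv))
  have hvx : ¬ G.Adj x v := same x (hKS hx) v hv hxv
  have hxx'a : ¬ G.Adj x x' := same x (hKS hx) x' (hKS hx') hgx'.symm
  -- If the pair of `y` gets filled, `x`, `x'` and `v` remain. An attack must come at `v` or `w`,
  -- and leaves `x`, `x'` and the other of the two. Either way `x` keeps two non-neighbours, so no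
  -- cocktail party graph is left.
  refine mWin_first hb hg' ht' hU (hKS hyK) (by omega) (fun _ q hq hqU => ?_) ?_
  · have hcol : Col G (unplayed q) (t - 1) := by
      rw [hq]; exact hg'.col_filter_ne (hKS hyK) ht'
    have ht1 : 1 ≤ t := (card_pos.2 ⟨_, mem_image_of_mem g hv⟩).trans_le ht
    refine hE q (b - 1) (t - 1) (by rw [hq]; omega) (by rw [hq]; omega) (by omega) ?_ hcol
      (by omega)
    rw [hq]
    exact not_cocktail (memF x (hKS hx) hyx.symm hxy') (memF x' (hKS hx') hyx'.symm hx'y')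
      (memF v hv (ne_v hyK).symm (ne_v hy'K).symm) hxx' (ne_v hx).symm (ne_v hx') hxx'a hvx
  · rintro - u hu hgu hyu' q hq hqU
    have huy : u ≠ y := by rintro rfl; exact hgu rfl
    have hcq := card_erase_erase (hKS hyK) hu huy
    rw [← hq] at hcq
    refine hE q (b - 1) t (by omega) (by omega) (by omega) ?_ ?_ (by omega)
    · have huK : u ∉ K := fun huK => hgu (by
        have := hyu u huK huy hyu'
        rw [this, hg'v _ (ne_w hy'K), hg'v _ (ne_w hyK), hgyy'])
      have mem : ∀ z ∈ K, z ≠ y → z ∈ unplayed q := by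
        intro z hz hzy
        rw [hq]
        exact mem_erase.2 ⟨fun h => huK (h ▸ hz), mem_erase.2 ⟨hzy, hKS hz⟩⟩
      rcases hS u hu with rfl | rfl | h
      · refine not_cocktail (y := x') (z := w) (mem x hx hyx.symm) (mem x' hx' hyx'.symm) ?_
          hxx' (ne_w hx).symm (ne_w hx') hxx'a fun h => hwx h.symm
        rw [hq]
        exact mem_erase.2 ⟨hwv, mem_erase.2 ⟨(ne_w hyK).symm, hw⟩⟩
      · refine not_cocktail (y := x') (z := v) (mem x hx hyx.symm) (mem x' hx' hyx'.symm) ?_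
          hxx' (ne_v hx).symm (ne_v hx') hxx'a hvx
        rw [hq]
        exact mem_erase.2 ⟨hwv.symm, mem_erase.2 ⟨(ne_v hyK).symm, hv⟩⟩
      · exact (huK h).elim
    · rw [hq]
      exact Col.mono ⟨g, hg, ht⟩ ((erase_subset _ _).trans (erase_subset _ _))

/-! ### Colour classes of size at least two -/

lemma card_class_add (S : Finset V) (g : V → ℕ) (v : V) :
    #{u ∈ S | g u = g v} + #{u ∈ S | g u ≠ g v} = #S := by
  simpa using card_filter_add_card_filter_not (s := S) (fun u => g u = g v)

/-- All colour classes on `S` have at least two elements, and there are at least two of them. -/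
def Fat (S : Finset V) (g : V → ℕ) : Prop :=
  ∀ v ∈ S, (∃ u ∈ S, u ≠ v ∧ g u = g v) ∧ ∃ u ∈ S, g u ≠ g v

lemma Fat.two_le_class (h : Fat S g) (hv : v ∈ S) : 2 ≤ #{u ∈ S | g u = g v} := by
  obtain ⟨u, hu, huv, hgu⟩ := (h v hv).1
  rw [← card_pair huv]
  exact card_le_card fun w hw => by
    rw [mem_insert, mem_singleton] at hw
    rcases hw with rfl | rfl <;> simp [*]

lemma Fat.two_le_compl (h : Fat S g) (hv : v ∈ S) : 2 ≤ #{u ∈ S | g u ≠ g v} := by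
  obtain ⟨u, hu, hgu⟩ := (h v hv).2
  refine (h.two_le_class hu).trans (card_le_card fun w hw => ?_)
  rw [mem_filter] at hw ⊢
  exact ⟨hw.1, hw.2.symm ▸ hgu⟩

lemma Fat.two_le_image (h : Fat S g) (hv : v ∈ S) : 2 ≤ #(S.image g) := by
  obtain ⟨u, hu, hgu⟩ := (h v hv).2
  rw [← card_pair hgu]
  exact card_le_card fun w hw => by
    rw [mem_insert, mem_singleton] at hw
    rcases hw with rfl | rfl <;> exact mem_image_of_mem g ‹_›

lemma exists_eq_pair (hv : v ∈ S) (h : #{u ∈ S | g u = g v} = 2) :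
    ∃ v' ∈ S, v' ≠ v ∧ g v' = g v ∧ ∀ u ∈ S, g u = g v → u = v ∨ u = v' := by
  have hv' : v ∈ ({u ∈ S | g u = g v} : Finset V) := by simp [hv]
  have h1 := card_erase_add_one hv'
  obtain ⟨v', h2⟩ := card_eq_one.1 (by omega : #(({u ∈ S | g u = g v} : Finset V).erase v) = 1)
  have h3 : v' ∈ (({u ∈ S | g u = g v} : Finset V).erase v) := by simp [h2]
  rw [mem_erase, mem_filter] at h3
  refine ⟨v', h3.2.1, h3.1, h3.2.2, fun u hu hgu => ?_⟩
  by_cases huv : u = v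
  · exact Or.inl huv
  · have : u ∈ (({u ∈ S | g u = g v} : Finset V).erase v) := by simp [huv, hu, hgu]
    rw [h2, mem_singleton] at this
    exact Or.inr this

/-- Eight or more vertices and all colour classes of size at least two. -/
lemma mWin_of_fat {b : ℕ} (hE : EvenWin G k (#(unplayed p) - 2))
    (hb : #(unplayed p) = 2 * b) (hb4 : 4 ≤ b) (hg : ProperOn G (unplayed p) g)
    (ht : #((unplayed p).image g) ≤ t) (hU : t + b ≤ #(unused p) + 2)
    (hS : ¬ Cocktail G (unplayed p)) (hfat : Fat (unplayed p) g) : MWin G p := by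
  by_cases hI : ∃ v ∈ unplayed p, ∃ w ∈ unplayed p, w ≠ v ∧ ¬ G.Adj v w ∧
      Cocktail G (((unplayed p).erase v).erase w) ∧ t + 1 ≤ b
  · obtain ⟨v, hv, w, hw, hwv, hvw, hK, htb⟩ := hI
    exact mWin_of_cocktail_erase hE hb hb4 hg ht hU htb hv hw hwv hvw hK
  push Not at hI
  obtain ⟨v₀, hv₀⟩ := card_pos.1 (by omega : 0 < #(unplayed p))
  have ht2 := (hfat.two_le_image hv₀).trans ht
  have kill : ∀ v ∈ unplayed p, ∀ w ∈ unplayed p, g w ≠ g v → ¬ G.Adj v w → ∀ q : V → Mark k,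
      unplayed q = ((unplayed p).erase v).erase w → #(unused p) ≤ #(unused q) + 1 →
      MWin G q := by
    intro v hv w hw hgw hvw q hq hqU
    have hwv : w ≠ v := by rintro rfl; exact hgw rfl
    have hcq := card_erase_erase hv hw hwv
    rw [← hq] at hcq
    by_cases hK : Cocktail G (unplayed q)
    · have htb := hI v hv w hw hwv hvw (hq ▸ hK)
      -- Here `b ≤ t`, while the cocktail party graph left needs only `b - 1` colours; this saving
      -- covers the deficit.
      exact (Layout.ofCol hK.col).mWin_of_reserve (d := b - 2) (by omega) (by omega)
    · refine hE q (b - 1) t (by omega) (by omega) (by omega) hK ?_ (by omega)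
      rw [hq]
      exact Col.mono ⟨g, hg, ht⟩ ((erase_subset _ _).trans (erase_subset _ _))
  have first : ∀ v ∈ unplayed p, (Even #{u ∈ unplayed p | g u = g v} → ∀ q : V → Mark k,
      unplayed q = {u ∈ unplayed p | g u ≠ g v} →
      t + #{u ∈ unplayed p | g u ≠ g v} / 2 ≤ #(unused q) + 3 → MWin G q) → MWin G p :=
    fun v hv hend => mWin_first hb hg ht hU hv (hfat.two_le_compl hv) hend fun _ => kill v hv
  have fresh : ∀ v ∈ unplayed p, 6 ≤ #{u ∈ unplayed p | g u ≠ g v} →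
      ¬ Cocktail G {u ∈ unplayed p | g u ≠ g v} → Even #{u ∈ unplayed p | g u = g v} →
      ∀ q : V → Mark k, unplayed q = {u ∈ unplayed p | g u ≠ g v} →
      t + #{u ∈ unplayed p | g u ≠ g v} / 2 ≤ #(unused q) + 3 → MWin G q := by
    intro v hv h6 hC he q hq hqU
    have h1 := card_class_add (unplayed p) g v
    have h2 := hfat.two_le_class hv
    obtain ⟨a, ha⟩ := he
    have hcol := hg.col_filter_ne hv ht
    rw [← hq] at hcol hC h1 hqU h6
    exact hE q (b - a) (t - 1) (by omega) (by omega) (by omega) hC hcol (by omega)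
  by_cases hodd : ∃ v ∈ unplayed p, ¬ Even #{u ∈ unplayed p | g u = g v}
  · obtain ⟨v, hv, ho⟩ := hodd
    exact first v hv fun he => (ho he).elim
  push Not at hodd
  by_cases hbig : ∃ v ∈ unplayed p, 3 ≤ #{u ∈ unplayed p | g u = g v}
  · obtain ⟨v, hv, h3⟩ := hbig
    -- Opening outside the big class keeps it in `F`. It contains three independent vertices, so `F`
    -- is no cocktail party graph; and if `F` has fewer than six vertices, parity makes it equal to
    -- the big class.
    obtain ⟨u, hu, hgu⟩ := (hfat v hv).2
    have hsub : ({w ∈ unplayed p | g w = g v} : Finset V) ⊆ {w ∈ unplayed p | g w ≠ g u} := by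
      intro w hw
      rw [mem_filter] at hw ⊢
      exact ⟨hw.1, fun h => hgu (h.symm.trans hw.2)⟩
    have hle := card_le_card hsub
    have h1 := card_class_add (unplayed p) g u
    obtain ⟨a, ha⟩ := hodd u hu
    obtain ⟨a', ha'⟩ := hodd v hv
    by_cases h6 : 6 ≤ #{w ∈ unplayed p | g w ≠ g u}
    · refine first u hu (fresh u hu h6 ?_)
      obtain ⟨x, y, z, hx, hy, hz, hxy, hxz, hyz⟩ := two_lt_card_iff.1 h3
      rw [mem_filter] at hx hy hz
      exact not_cocktail (hsub (mem_filter.2 hx)) (hsub (mem_filter.2 hy))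
        (hsub (mem_filter.2 hz)) hxy.symm hxz.symm hyz
        (fun h => hg x hx.1 y hy.1 h (hx.2.trans hy.2.symm))
        (fun h => hg x hx.1 z hz.1 h (hx.2.trans hz.2.symm))
    · have heq := eq_of_subset_of_card_le hsub (by omega)
      refine first u hu fun _ q hq hqU => ?_
      refine win_of_indep_of_unused _ (fun x hx y hy h => ?_) (by omega)
      rw [hq, ← heq, mem_filter] at hx hy
      exact hg x hx.1 y hy.1 h (hx.2.trans hy.2.symm)
  · push Not at hbig
    have hpair : ∀ v ∈ unplayed p, #{u ∈ unplayed p | g u = g v} = 2 := by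
      intro v hv
      have := hbig v hv
      have := hfat.two_le_class hv
      omega
    by_cases hC : ∃ v ∈ unplayed p, ¬ Cocktail G {u ∈ unplayed p | g u ≠ g v}
    · obtain ⟨v, hv, hCv⟩ := hC
      have h1 := card_class_add (unplayed p) g v
      have := hpair v hv
      exact first v hv (fresh v hv (by omega) hCv)
    · push Not at hC
      -- Deleting any pair leaves a cocktail party graph. A non-neighbour `w` of `v` outside its
      -- pair would survive the deletion of a third pair and give `v` two non-neighbours.
      refine (hS fun v hv => ?_).elim
      obtain ⟨v', hv', hne, hgv', huniq⟩ := exists_eq_pair hv (hpair v hv)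
      have hvv' : ¬ G.Adj v v' := fun h => hg v hv v' hv' h hgv'.symm
      refine ⟨v', hv', hne, hvv', fun w hw hwv hvw => ?_⟩
      by_cases hgw : g w = g v
      · exact (huniq w hw hgw).resolve_left hwv
      obtain ⟨z, hz⟩ : (unplayed p \ ({u ∈ unplayed p | g u = g v} ∪
          {u ∈ unplayed p | g u = g w})).Nonempty := by
        rw [← card_pos]
        have h1 := le_card_sdiff ({u ∈ unplayed p | g u = g v} ∪
          {u ∈ unplayed p | g u = g w}) (unplayed p)
        have h2 := card_union_le ({u ∈ unplayed p | g u = g v}) {u ∈ unplayed p | g u = g w}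
        have := hpair v hv
        have := hpair w hw
        omega
      simp only [mem_sdiff, mem_union, mem_filter, not_or, not_and] at hz
      obtain ⟨hz, hzv, hzw⟩ := hz
      have hv'w : v' ≠ w := by rintro rfl; exact hgw hgv'
      refine (not_cocktail (K := {u ∈ unplayed p | g u ≠ g z}) (v := v) (y := v') (z := w)
        ?_ ?_ ?_ hne hwv hv'w hvv' hvw (hC z hz)).elim
      · exact mem_filter.2 ⟨hv, fun h => hzv hz h.symm⟩
      · exact mem_filter.2 ⟨hv', fun h => hzv hz (h.symm.trans hgv')⟩
      · exact mem_filter.2 ⟨hw, fun h => hzw hz h.symm⟩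

lemma freeNbrs_subset (hg : ProperOn G (unplayed p) g) (hv : v ∈ unplayed p) :
    freeNbrs G p v ⊆ {u ∈ unplayed p | g u ≠ g v} := by
  intro u hu
  rw [mem_freeNbrs] at hu
  exact mem_filter.2 ⟨hu.1, (hg v hv u hu.1 hu.2).symm⟩

/-- Six vertices in three pairs. -/
lemma mWin_of_three_pairs (h6 : #(unplayed p) = 6) (hg : ProperOn G (unplayed p) g)
    (ht : #((unplayed p).image g) ≤ t) (hU : t + 1 ≤ #(unused p)) (hU4 : 4 ≤ #(unused p))
    (hS : ¬ Cocktail G (unplayed p))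
    (hpair : ∀ v ∈ unplayed p, #{u ∈ unplayed p | g u = g v} = 2) : MWin G p := by
  have hcompl : ∀ v ∈ unplayed p, #{u ∈ unplayed p | g u ≠ g v} = 4 := by
    intro v hv
    have := card_class_add (unplayed p) g v
    have := hpair v hv
    omega
  by_cases hdeg : ∃ x ∈ unplayed p, ∀ u ∈ unplayed p, g u ≠ g x → G.Adj x u
  swap
  · push Not at hdeg
    refine win_of_secure _ fun v hv => secure_of_card_lt ?_
    obtain ⟨u, hu, hgu, hvu⟩ := hdeg v hv
    refine lt_of_lt_of_le (card_lt_card (t := {u ∈ unplayed p | g u ≠ g v}) ?_)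
      ((hcompl v hv).trans_le hU4)
    refine (ssubset_iff_of_subset (freeNbrs_subset hg hv)).2 ⟨u, mem_filter.2 ⟨hu, hgu⟩, ?_⟩
    rw [mem_freeNbrs]
    exact fun h => hvu h.2
  -- the first move at a vertex of degree four
  have first : ∀ x ∈ unplayed p, ∀ x' ∈ unplayed p, x' ≠ x → g x' = g x →
      (∀ u ∈ unplayed p, g u ≠ g x → G.Adj x u) →
      (∀ q : V → Mark k, ∀ c, Layout G q ∅ ∅ {u ∈ unplayed p | g u ≠ g x} {c} ∅ (t - 1) →
        #(unused p) ≤ #(unused q) + 2 →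
        (∀ u ∈ unplayed p, g u ≠ g x → ¬ G.Adj u x' → c ∉ seen G q u) → MWin G q) →
      MWin G p := by
    intro x hx x' hx' hne hgx hadj hA
    obtain ⟨c, hc⟩ := card_pos.1 (by omega : 0 < #(unused p))
    have hcs : c ∉ seen G p x := notMem_seen_of_unused hc
    have hL := singleton_layout hx hc hg ht
    have hr := isReply_colour hx hcs
    have hrc := hr.card
    have hUc := card_unused_update_of_mem hx hc
    have ht1 : 1 ≤ t := (card_pos.2 ⟨_, mem_image_of_mem g hx⟩).trans_le ht
    have hF := hcompl x hx
    refine mWin_of_move hx hcs (hL.bWin_of_step (by omega) (card_pos.1 (by omega)) ?_ ?_ ?_ ?_)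
    · intro w y hr' A' Γ' h' hU'
      have := hr'.card
      exact h'.mWin_of_reserve (d := 1) (by omega) (by omega)
    · intro w hw d hd
      exact hL.mWin_of_new (d := 1) (by omega) (by omega) hw hd
    -- The one costly reply is a new colour `d` at the mate `x'`; vertices not adjacent to `x'` may
    -- still take `d`.
    · intro w hw d hd
      obtain ⟨x'', -, hx'', hgx'', huniq⟩ := exists_eq_pair hx (hpair x hx)
      have hw' := hw
      rw [mem_erase, mem_filter] at hw'
      have hwx' : w = x' := by
        rw [(huniq w hw'.2.1 hw'.2.2).resolve_left hw'.1, (huniq x' hx' hgx).resolve_left hne]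
      subst hwx'
      have h1 := hL.colour_left hw (Or.inl hd)
      have h2 : (({u ∈ unplayed p | g u = g x} : Finset V).erase x).erase w = ∅ := by
        have := card_erase_erase (S := {u ∈ unplayed p | g u = g x}) (v := x) (w := w)
          (by simp [hx]) (by simp [hx', hgx]) hne
        have := hpair x hx
        exact card_eq_zero.1 (by omega)
      rw [h2] at h1
      have h3 := card_unused_update_of_mem (hL.memA hw) hd
      refine hA _ d (h1.shrink (by simp) (by simp)) (by omega) fun u hu hgu hux' => ?_
      rw [mem_seen_update (hL.memA hw)]
      rintro (h' | ⟨h', -⟩)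
      · exact notMem_seen_of_unused hd h'
      · exact hux' h'
    · intro d hd _ w hw hdw
      obtain rfl : c = d := by simpa using hd
      rw [mem_filter] at hw
      exact (hdw ((mem_seen_update hx).2 (Or.inr ⟨(hadj w hw.1 hw.2).symm, rfl⟩))).elim
  have mate : ∀ v ∈ unplayed p, ∃ v' ∈ unplayed p, v' ≠ v ∧ g v' = g v ∧
      ∀ u ∈ unplayed p, g u = g v → u = v ∨ u = v' := fun v hv => exists_eq_pair hv (hpair v hv)
  have empty_layout : ∀ {q : V → Mark k} {F c}, Layout G q ∅ ∅ F {c} ∅ (t - 1) →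
      unplayed q = F := fun h => by simpa using h.cover
  by_cases hbad : ∃ x ∈ unplayed p, (∀ u ∈ unplayed p, g u ≠ g x → G.Adj x u) ∧
      ∃ x' ∈ unplayed p, x' ≠ x ∧ g x' = g x ∧ ∃ h ∈ unplayed p, g h ≠ g x ∧ ¬ G.Adj h x'
  · obtain ⟨x, hx, hadj, x', hx', hne, hgx, h, hh, hgh, hhx'⟩ := hbad
    refine first x hx x' hx' hne hgx hadj fun q c hL hqU hsafe => ?_
    have hq := empty_layout hL
    have hhq : h ∈ unplayed q := by rw [hq]; exact mem_filter.2 ⟨hh, hgh⟩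
    have hcs := hsafe h hh hgh hhx'
    have hr := isReply_colour hhq hcs
    have hrc := hr.card
    have hL' := (hL.shrink (empty_subset _) (by simp)).reply hr (by simp) (by simp)
    rw [hq, hcompl x hx] at hrc
    have ht1 : 1 ≤ t := (card_pos.2 ⟨_, mem_image_of_mem g hx⟩).trans_le ht
    have hcard : #(({u ∈ unplayed p | g u ≠ g x} : Finset V).erase h) = 3 := by
      rw [← hq, ← hr.unplayed_eq]; omega
    -- Repeating Breaker's colour at `h` spends no new colour. Breaker then faces three vertices and
    -- no safe set, and must waste a move.
    refine mWin_of_move hhq hcs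
      (Layout.bWin_of_one_save (b := 1) hL' (by omega) (by omega) ?_ (by simp) (by simp))
    rw [unused_update_of_notMem hhq (Finset.disjoint_left.1 hL.usedA (mem_singleton_self c))]
    omega
  · push Not at hbad
    obtain ⟨x, hx, hadj⟩ := hdeg
    obtain ⟨x', hx', hne, hgx, hxu⟩ := mate x hx
    have hadj' := fun u hu hgu => hbad x hx hadj x' hx' hne hgx u hu hgu
    -- Two pairs complete to the rest would make the third one complete as well, giving a cocktail
    -- party graph.
    have hnob : ∀ b ∈ unplayed p, g b ≠ g x → ∃ u ∈ unplayed p, g u ≠ g b ∧ ¬ G.Adj b u := by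
      by_contra! hb
      obtain ⟨b, hb, hgb, hadjb⟩ := hb
      obtain ⟨b', hb', hneb, hgbb, hbu⟩ := mate b hb
      have hadjb' := fun u hu hgu => hbad b hb hadjb b' hb' hneb hgbb u hu hgu
      refine hS fun y hy => ?_
      obtain ⟨y', hy', hney, hgy, hyu⟩ := mate y hy
      refine ⟨y', hy', hney, fun h => hg y hy y' hy' h hgy.symm, fun w hw hwy hyw => ?_⟩
      by_cases hgw : g w = g y
      · exact (hyu w hw hgw).resolve_left hwy
      exfalso
      -- vertices outside two classes form the third
      have hxadj : ∀ z ∈ unplayed p, g z = g x → ∀ u ∈ unplayed p, g u ≠ g x → G.Adj z u := by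
        intro z hz hgz u hu hgu
        rcases hxu z hz hgz with rfl | rfl
        · exact hadj u hu hgu
        · exact (hadj' u hu hgu).symm
      have hbadj : ∀ z ∈ unplayed p, g z = g b → ∀ u ∈ unplayed p, g u ≠ g b → G.Adj z u := by
        intro z hz hgz u hu hgu
        rcases hbu z hz hgz with rfl | rfl
        · exact hadjb u hu hgu
        · exact (hadjb' u hu hgu).symm
      have h1 : g y ≠ g x := fun h => hyw (hxadj y hy h w hw (h ▸ hgw))
      have h2 : g y ≠ g b := fun h => hyw (hbadj y hy h w hw (h ▸ hgw))
      have h3 : g w ≠ g x := fun h => hyw (hxadj w hw h y hy h1).symm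
      have h4 : g w ≠ g b := fun h => hyw (hbadj w hw h y hy h2).symm
      have h5 : ({g x, g b, g y, g w} : Finset ℕ) ⊆ (unplayed p).image g := by
        intro d hd
        simp only [mem_insert, mem_singleton] at hd
        rcases hd with rfl | rfl | rfl | rfl <;> exact mem_image_of_mem g ‹_›
      have h6' := card_le_card h5
      rw [card_insert_of_notMem (by simp [hgb.symm, h1.symm, h3.symm]),
        card_insert_of_notMem (by simp [h2.symm, h4.symm]),
        card_pair (Ne.symm hgw)] at h6'
      have h7 := card_eq_sum_card_image g (unplayed p)
      rw [sum_const_nat (m := 2), h6] at h7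
      · omega
      · intro d hd
        obtain ⟨z, hz, rfl⟩ := mem_image.1 hd
        exact hpair z hz
    refine first x hx x' hx' hne hgx hadj fun q c hL hqU _ => ?_
    have hq := empty_layout hL
    refine win_of_secure _ fun b hb => secure_of_card_lt ?_
    have hb' := hb
    rw [hq, mem_filter] at hb'
    obtain ⟨u, hu, hgu, hbu⟩ := hnob b hb'.1 hb'.2
    have hux : g u ≠ g x := by
      intro h
      rcases hxu u hu h with rfl | rfl
      · exact hbu (hadj b hb'.1 hb'.2).symm
      · exact hbu (hadj' b hb'.1 hb'.2)
    -- at most one neighbour of `b` is left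
    have hsub : insert u (freeNbrs G q b) ∪ {w ∈ unplayed p | g w = g b} ⊆
        {w ∈ unplayed p | g w ≠ g x} := by
      intro w hw
      simp only [mem_union, mem_insert, mem_freeNbrs, mem_filter, hq] at hw ⊢
      rcases hw with (rfl | hw) | hw
      · exact ⟨hu, hux⟩
      · exact hw.1
      · exact ⟨hw.1, hw.2 ▸ hb'.2⟩
    have hdisj : Disjoint (insert u (freeNbrs G q b)) {w ∈ unplayed p | g w = g b} := by
      rw [Finset.disjoint_left]
      intro w hw hw'
      simp only [mem_insert, mem_freeNbrs, mem_filter, hq] at hw hw'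
      rcases hw with rfl | hw
      · exact hgu hw'.2
      · exact hg b hb'.1 w hw'.1 hw.2 hw'.2.symm
    have h1 := card_le_card hsub
    rw [card_union_of_disjoint hdisj, hcompl x hx, hpair b hb'.1,
      card_insert_of_notMem (by simp [mem_freeNbrs, hbu])] at h1
    omega

/-- Six vertices and all colour classes of size at least two. -/
lemma mWin_of_fat_six (h6 : #(unplayed p) = 6) (hg : ProperOn G (unplayed p) g)
    (ht : #((unplayed p).image g) ≤ t) (hU : t + 1 ≤ #(unused p))
    (hS : ¬ Cocktail G (unplayed p)) (hfat : Fat (unplayed p) g) : MWin G p := by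
  obtain ⟨v₀, hv₀⟩ := card_pos.1 (by omega : 0 < #(unplayed p))
  have ht2 := (hfat.two_le_image hv₀).trans ht
  -- The class sizes are 3 + 3, 4 + 2 or 2 + 2 + 2.
  by_cases h3 : ∃ v ∈ unplayed p, #{u ∈ unplayed p | g u = g v} = 3
  · obtain ⟨v, hv, h3⟩ := h3
    have hcv := card_class_add (unplayed p) g v
    have hall : ∀ y ∈ unplayed p, #{u ∈ unplayed p | g u = g y} = 3 := by
      intro y hy
      by_cases hgy : g y = g v
      · rw [hgy]; exact h3
      have hsub : ({u ∈ unplayed p | g u = g y} : Finset V) ⊆ {u ∈ unplayed p | g u ≠ g v} := by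
        intro u hu
        rw [mem_filter] at hu ⊢
        exact ⟨hu.1, hu.2 ▸ hgy⟩
      have h4 := card_le_card hsub
      have h5 := hfat.two_le_class hy
      by_contra hne
      have h6 : ∃ u ∈ ({u ∈ unplayed p | g u ≠ g v} : Finset V),
          u ∉ ({u ∈ unplayed p | g u = g y} : Finset V) := by
        by_contra! h
        have := card_le_card (show ({u ∈ unplayed p | g u ≠ g v} : Finset V) ⊆
          {u ∈ unplayed p | g u = g y} from h)
        omega
      obtain ⟨u, hu, hu'⟩ := h6
      rw [mem_filter] at hu
      have hgu : g u ≠ g y := fun h => hu' (mem_filter.2 ⟨hu.1, h⟩)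
      have h7 := hfat.two_le_class hu.1
      have hd : Disjoint ({w ∈ unplayed p | g w = g y} : Finset V) {w ∈ unplayed p | g w = g u} :=
        disjoint_filter.2 fun w _ h h' => hgu (h'.symm.trans h)
      have h8 : ({w ∈ unplayed p | g w = g y} : Finset V) ∪ {w ∈ unplayed p | g w = g u} ⊆
          {w ∈ unplayed p | g w ≠ g v} := by
        refine union_subset hsub fun w hw => ?_
        rw [mem_filter] at hw ⊢
        exact ⟨hw.1, hw.2 ▸ hu.2⟩
      have h9 := card_le_card h8
      rw [card_union_of_disjoint hd] at h9
      omega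
    by_cases hdom : ∃ y ∈ unplayed p, ∀ w ∈ unplayed p, g w ≠ g y → G.Adj y w
    · obtain ⟨y, hy, hdom⟩ := hdom
      refine mWin_first (b := 3) h6 hg ht (by omega) hy (hfat.two_le_compl hy) (fun he => ?_) ?_
      · rw [hall y hy] at he
        exact absurd he (by decide)
      · exact fun _ w hw hgw hyw => (hyw (hdom w hw hgw)).elim
    · push Not at hdom
      refine win_of_secure _ fun y hy => secure_of_card_lt ?_
      obtain ⟨w, hw, hgw, hyw⟩ := hdom y hy
      have hcy := card_class_add (unplayed p) g y
      rw [hall y hy] at hcy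
      refine lt_of_lt_of_le (card_lt_card (t := {u ∈ unplayed p | g u ≠ g y}) ?_)
        (by omega)
      refine (ssubset_iff_of_subset (freeNbrs_subset hg hy)).2 ⟨w, mem_filter.2 ⟨hw, hgw⟩, ?_⟩
      rw [mem_freeNbrs]
      exact fun h => hyw h.2
  push Not at h3
  by_cases h4 : ∃ v ∈ unplayed p, 4 ≤ #{u ∈ unplayed p | g u = g v}
  · obtain ⟨v, hv, h4⟩ := h4
    have hcv := card_class_add (unplayed p) g v
    have h2 := hfat.two_le_compl hv
    obtain ⟨r₁, r₂, -, hr⟩ := card_eq_two.1 (by omega : #{u ∈ unplayed p | g u ≠ g v} = 2)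
    have hr₁ : r₁ ∈ ({u ∈ unplayed p | g u ≠ g v} : Finset V) := by simp [hr]
    refine mWin_of_two (r₁ := r₁) (r₂ := r₂) (by omega) (mem_filter.1 hr₁).1
      fun y hy h1 h2 => ?_
    have hgy : g y = g v := by
      by_contra h
      have : y ∈ ({u ∈ unplayed p | g u ≠ g v} : Finset V) := mem_filter.2 ⟨hy, h⟩
      simp [hr, h1, h2] at this
    have := card_le_card (freeNbrs_subset hg hy)
    rw [hgy] at this
    omega
  · push Not at h4
    have hpair : ∀ v ∈ unplayed p, #{u ∈ unplayed p | g u = g v} = 2 := by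
      intro v hv
      have := hfat.two_le_class hv
      have := h3 v hv
      have := h4 v hv
      omega
    refine mWin_of_three_pairs h6 hg ht hU ?_ hS hpair
    have h7 := card_eq_sum_card_image g (unplayed p)
    rw [sum_const_nat (m := 2), h6] at h7
    · omega
    · intro d hd
      obtain ⟨z, hz, rfl⟩ := mem_image.1 hd
      exact hpair z hz

/-- A singleton class is an ideal opening: `A` is empty, so there is nothing to attack. Otherwise
all classes have at least two vertices, and six vertices form the base of the induction. -/
lemma evenWin (G : SimpleGraph V) (k n : ℕ) : EvenWin G k n := by
  induction n using Nat.strong_induction_on with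
  | _ n ih =>
  intro p b t hb hn hb3 hS ⟨g, hg, ht⟩ hU
  have hne : (unplayed p).Nonempty := card_pos.1 (by omega)
  have ht1 : 1 ≤ t := (card_pos.2 (hne.image g)).trans_le ht
  by_cases hind : ∃ v ∈ unplayed p, ∀ u ∈ unplayed p, g u = g v
  · obtain ⟨v, hv, hind⟩ := hind
    refine win_of_indep_of_unused _ (fun u hu w hw h => ?_) (by omega)
    exact hg u hu w hw h ((hind u hu).trans (hind w hw).symm)
  push Not at hind
  by_cases hsing : ∃ v ∈ unplayed p, ∀ u ∈ unplayed p, u ≠ v → g u ≠ g v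
  · obtain ⟨v, hv, hsing⟩ := hsing
    have hcls : ({u ∈ unplayed p | g u = g v} : Finset V) = {v} := by
      ext u
      simp only [mem_filter, mem_singleton]
      constructor
      · rintro ⟨hu, h⟩
        by_contra huv
        exact hsing u hu huv h
      · rintro rfl
        exact ⟨hv, rfl⟩
    have hc := card_class_add (unplayed p) g v
    rw [hcls, card_singleton] at hc
    refine mWin_first hb hg ht hU hv (by omega) (fun he => ?_) ?_
    · rw [hcls, card_singleton] at he
      exact absurd he (by decide)
    · rintro ⟨u, hu, huv, hgu⟩
      exact (hsing u hu huv hgu).elim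
  push Not at hsing
  have hfat : Fat (unplayed p) g := fun v hv => ⟨hsing v hv, hind v hv⟩
  by_cases hb4 : 4 ≤ b
  · exact mWin_of_fat (ih _ (by omega)) hb hb4 hg ht hU hS hfat
  · exact mWin_of_fat_six (by omega) hg ht (by omega) hS hfat

/-! ### Odd positions with two colours missing -/

/-- The first move of Maker on an odd number of unplayed vertices, in an odd class. -/
lemma mWin_first_odd {b : ℕ} (hb : #(unplayed p) = 2 * b + 1) (hg : ProperOn G (unplayed p) g)
    (ht : #((unplayed p).image g) ≤ t) (hU : t + b ≤ #(unused p) + 2) (hv : v ∈ unplayed p)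
    (ho : Odd #{u ∈ unplayed p | g u = g v}) (hF : 4 ≤ #{u ∈ unplayed p | g u ≠ g v})
    (hgF : (∃ u ∈ unplayed p, u ≠ v ∧ g u = g v) → ∀ w ∈ unplayed p, g w ≠ g v →
      2 ≤ #{u ∈ {u ∈ unplayed p | g u ≠ g v} | g u ≠ g w})
    (hkill : (∃ u ∈ unplayed p, u ≠ v ∧ g u = g v) →
      ∀ w ∈ unplayed p, g w ≠ g v → ¬ G.Adj v w → ∀ q : V → Mark k,
      unplayed q = ((unplayed p).erase v).erase w → #(unused p) ≤ #(unused q) + 1 → MWin G q) :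
    MWin G p := by
  have hcl := card_class_add (unplayed p) g v
  have hv' : v ∈ ({u ∈ unplayed p | g u = g v} : Finset V) := by simp [hv]
  have hc1 := card_pos.2 ⟨v, hv'⟩
  have ht1 : 1 ≤ t := (card_pos.2 ⟨_, mem_image_of_mem g hv⟩).trans_le ht
  obtain ⟨c, hc⟩ := card_pos.1 (by omega : 0 < #(unused p))
  have hcs : c ∉ seen G p v := notMem_seen_of_unused hc
  have hr := isReply_colour hv hcs
  have hrc := hr.card
  have hUc := card_unused_update_of_mem hv hc
  refine mWin_of_move hv hcs ((singleton_layout hv hc hg ht).bWin_of_two_saves (b := b)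
    (by omega) ?_ hF (by omega) (hg.mono (filter_subset _ _)) ?_ ?_ (kill_of_first hv hc hkill))
  · rw [← card_erase_add_one hv'] at ho
    simpa [Nat.odd_add_one] using ho
  · have := ProperOn.card_image_filter_ne (g := g) hv
    omega
  · rintro ⟨u, hu⟩ w hw
    rw [mem_erase, mem_filter] at hu
    rw [mem_filter] at hw
    exact hgF ⟨u, hu.2.1, hu.1, hu.2.2⟩ w hw.1 hw.2

/-! ### Filling up one side of a bipartite graph -/

/-- The unplayed vertices are split into independent sets `A` and `B`, which see among the colours
in `C` only those in `X` and `Y`, respectively. -/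
structure Fill (G : SimpleGraph V) (p : V → Mark k) (A B : Finset V) (C X Y : Finset (Fin k)) :
    Prop where
  cover : unplayed p = A ∪ B
  disj : Disjoint A B
  indepA : ∀ u ∈ A, ∀ v ∈ A, ¬ G.Adj u v
  indepB : ∀ u ∈ B, ∀ v ∈ B, ¬ G.Adj u v
  seenA : ∀ v ∈ A, ∀ c ∈ C, c ∈ seen G p v → c ∈ X
  seenB : ∀ v ∈ B, ∀ c ∈ C, c ∈ seen G p v → c ∈ Y

variable {C X Y : Finset (Fin k)}

namespace Fill

lemma symm (h : Fill G p A B C X Y) : Fill G p B A C Y X :=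
  ⟨by rw [h.cover, union_comm], h.disj.symm, h.indepB, h.indepA, h.seenB, h.seenA⟩

lemma memA (h : Fill G p A B C X Y) (hv : v ∈ A) : v ∈ unplayed p := by simp [h.cover, hv]

lemma memB (h : Fill G p A B C X Y) (hv : v ∈ B) : v ∈ unplayed p := by simp [h.cover, hv]

lemma colour_left (h : Fill G p A B C X Y) (hw : w ∈ A) :
    Fill G (update p w (Mark.colour c)) (A.erase w) B C X (insert c Y) where
  cover := by
    rw [unplayed_update (by simp), h.cover, erase_union_distrib,
      erase_eq_of_notMem (Finset.disjoint_left.1 h.disj hw)]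
  disj := h.disj.mono_left (erase_subset _ _)
  indepA u hu v hv := h.indepA u (mem_of_mem_erase hu) v (mem_of_mem_erase hv)
  indepB := h.indepB
  seenA v hv d hd hs := by
    rw [seen_update_of_not_adj (h.memA hw) (h.indepA v (mem_of_mem_erase hv) w hw)] at hs
    exact h.seenA v (mem_of_mem_erase hv) d hd hs
  seenB v hv d hd hs := by
    rcases mem_insert.1 (seen_update_subset (h.memA hw) hs) with rfl | h'
    · exact mem_insert_self _ _
    · exact mem_insert_of_mem (h.seenB v hv d hd h')

lemma blank_left (h : Fill G p A B C X Y) (hw : w ∈ A) :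
    Fill G (update p w Mark.blank) (A.erase w) B C X Y where
  cover := by
    rw [unplayed_update (by simp), h.cover, erase_union_distrib,
      erase_eq_of_notMem (Finset.disjoint_left.1 h.disj hw)]
  disj := h.disj.mono_left (erase_subset _ _)
  indepA u hu v hv := h.indepA u (mem_of_mem_erase hu) v (mem_of_mem_erase hv)
  indepB := h.indepB
  seenA v hv d hd hs := by
    rw [seen_update_blank (h.memA hw)] at hs
    exact h.seenA v (mem_of_mem_erase hv) d hd hs
  seenB v hv d hd hs := by
    rw [seen_update_blank (h.memA hw)] at hs
    exact h.seenB v hv d hd hs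

/-- A move in `A` adds at most one colour to `Y`. -/
lemma reply_left (h : Fill G p A B C X Y) (hr : IsReply G p w x) (hw : w ∈ A) :
    ∃ Y', Fill G (update p w x) (A.erase w) B C X Y' ∧ #Y' ≤ #Y + 1 ∧
      Y ⊆ Y' ∧ ∀ d, d ∉ Y → x ≠ Mark.colour d → d ∉ Y' := by
  rcases hr.2 with rfl | ⟨c, -, rfl⟩
  · exact ⟨Y, h.blank_left hw, by omega, subset_rfl, fun d hd _ => hd⟩
  · refine ⟨_, h.colour_left hw, card_insert_le _ _, subset_insert _ _, fun d hd hdc h' => ?_⟩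
    rcases mem_insert.1 h' with rfl | h'
    · exact hdc rfl
    · exact hd h'

lemma exists_legal (h : Fill G p A B C X Y) (hv : v ∈ A) (hX : #X < #C) :
    ∃ c ∈ C, c ∉ seen G p v := by
  obtain ⟨c, hc, hcX⟩ := exists_mem_notMem_of_card_lt_card hX
  exact ⟨c, hc, fun hs => hcX (h.seenA v hv c hc hs)⟩

/-- A reply in `A` shortens `A` and adds at most one colour to `Y`; a reply in `B` adds at most one
to `X`, for which the first inequality has room. -/
lemma bWin_of_mWin {n : ℕ}
    (hM : ∀ (p : V → Mark k) (A B : Finset V) (X Y : Finset (Fin k)), Fill G p A B C X Y →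
      #A ≤ n → #X + #A ≤ #C → #Y + #A + 1 ≤ #C → MWin G p)
    (h : Fill G p A B C X Y) (hn : #A ≤ n) (hX : #X + #A + 1 ≤ #C) (hY : #Y + #A + 1 ≤ #C) :
    BWin G p := by
  rcases (unplayed p).eq_empty_or_nonempty with h0 | ⟨v, hv⟩
  · exact finished_of_unplayed_eq_empty h0
  refine bWin_of_reply ⟨v, hv, ?_⟩ fun w x hr => ?_
  · rw [h.cover, mem_union] at hv
    rcases hv with hv | hv
    · exact (h.exists_legal hv (by omega)).imp fun c hc => hc.2
    · exact (h.symm.exists_legal hv (by omega)).imp fun c hc => hc.2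
  · have hw := hr.1
    rw [h.cover, mem_union] at hw
    rcases hw with hw | hw
    · obtain ⟨Y', h', hY', -, -⟩ := h.reply_left hr hw
      have := card_erase_add_one hw
      exact hM _ _ _ _ _ h' (by omega) (by omega) (by omega)
    · obtain ⟨X', h', hX', -, -⟩ := h.symm.reply_left hr hw
      exact hM _ _ _ _ _ h'.symm (by omega) (by omega) (by omega)

/-- Maker keeps colouring `A`. Each of his moves lowers `#X + #A`, which pays for a reply in `B`,
and does not raise `#Y + #A`. Once `A` is full, the extra 1 leaves a colour for every vertex of the
independent set `B`. -/
lemma mWin (h : Fill G p A B C X Y) (hX : #X + #A ≤ #C) (hY : #Y + #A + 1 ≤ #C) : MWin G p := by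
  suffices H : ∀ n, ∀ (p : V → Mark k) (A B : Finset V) (X Y : Finset (Fin k)),
      Fill G p A B C X Y → #A ≤ n → #X + #A ≤ #C → #Y + #A + 1 ≤ #C → MWin G p from
    H _ p A B X Y h le_rfl hX hY
  intro n
  induction n with
  | zero =>
    intro p A B X Y h hn hX hY
    obtain rfl : A = ∅ := card_eq_zero.1 (by omega)
    refine win_of_secure _ fun v hv => Or.inr ?_
    rw [h.cover, empty_union] at hv
    obtain ⟨c, -, hc⟩ := h.symm.exists_legal hv (by omega)
    refine ⟨c, hc, fun u hu huv => ?_⟩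
    rw [h.cover, empty_union] at hu
    exact (h.indepB v hv u hu huv).elim
  | succ n ih =>
    intro p A B X Y h hn hX hY
    rcases A.eq_empty_or_nonempty with rfl | ⟨a, ha⟩
    · exact ih p ∅ B X Y h (by simp) hX hY
    have h1 := card_erase_add_one ha
    obtain ⟨c, -, hc⟩ := h.exists_legal ha (by omega)
    have h2 := card_insert_le c Y
    exact mWin_of_move (h.memA ha) hc
      (bWin_of_mWin ih (h.colour_left ha) (by omega) (by omega) (by omega))

lemma bWin (h : Fill G p A B C X Y) (hX : #X + #A + 1 ≤ #C) (hY : #Y + #A + 1 ≤ #C) :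
    BWin G p :=
  h.bWin_of_mWin (fun _ _ _ _ _ h' _ hX' hY' => h'.mWin hX' hY') le_rfl hX hY

end Fill

/-- Maker opens in `A` and tries to repeat his colour there. -/
lemma mWin_of_repeat (h : Fill G p A B (unused p) ∅ ∅) (hA : #A ≤ #(unused p))
    (hA2 : 2 ≤ #A) (hU : 3 ≤ #(unused p)) (ha : v ∈ A)
    (hkill : ∀ w ∈ B, ¬ G.Adj v w → (∀ a ∈ A, a ≠ v → G.Adj a w) → ∀ q : V → Mark k,
      unplayed q = ((unplayed p).erase v).erase w → #(unused p) ≤ #(unused q) + 1 → MWin G q) :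
    MWin G p := by
  obtain ⟨c, hc⟩ := card_pos.1 (by omega : 0 < #(unused p))
  have hcs : c ∉ seen G p v := notMem_seen_of_unused hc
  have hr := isReply_colour (h.memA ha) hcs
  have h1 := h.colour_left (c := c) ha
  rw [insert_empty_eq] at h1
  have hA1 := card_erase_add_one ha
  obtain ⟨v', hv'⟩ := card_pos.1 (by omega : 0 < #(A.erase v))
  refine mWin_of_move (h.memA ha) hcs (bWin_of_reply ⟨v', h1.memA hv', ?_⟩ fun w x hr' => ?_)
  · exact (h1.exists_legal hv' (by rw [card_empty]; omega)).imp fun c hc => hc.2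
  have hw := hr'.1
  rw [h1.cover, mem_union] at hw
  rcases hw with hw | hw
  · obtain ⟨Y', h2, hY', hYY', -⟩ := h1.reply_left hr' hw
    rw [card_singleton] at hY'
    have hA2 := card_erase_add_one hw
    rcases ((A.erase v).erase w).eq_empty_or_nonempty with h0 | ⟨a, ha⟩
    · rw [h0] at h2
      exact h2.mWin (by simp) (by simp; omega)
    · have hca : c ∉ seen G (update (update p v (Mark.colour c)) w x) a := fun hs => by
        simpa using h2.seenA a ha c hc hs
      have h3 := h2.colour_left (c := c) ha
      rw [insert_eq_of_mem (hYY' (mem_singleton_self c))] at h3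
      have hA3 := card_erase_add_one ha
      exact mWin_of_move (h2.memA ha) hca (h3.bWin (by rw [card_empty]; omega) (by omega))
  · obtain ⟨X', h2, hX', -, hXc⟩ := h1.symm.reply_left hr' hw
    rw [card_empty] at hX'
    by_cases hrep : ∃ a ∈ A.erase v, c ∉ seen G (update (update p v (Mark.colour c)) w x) a
    · obtain ⟨a, ha, hca⟩ := hrep
      have h3 := h2.symm.colour_left (c := c) ha
      rw [insert_eq_of_mem (mem_singleton_self c)] at h3
      have hA3 := card_erase_add_one ha
      exact mWin_of_move (h2.memB ha) hca (h3.bWin (by omega) (by rw [card_singleton]; omega))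
    -- If `c` cannot be repeated in `A`, Breaker has just played it at a vertex of `B` adjacent to
    -- all of `A` except `v`.
    push Not at hrep
    have hx : x = Mark.colour c := by
      by_contra hx
      exact hXc c (by simp) hx (h2.seenB v' hv' c hc (hrep v' hv'))
    subst hx
    have hvw : ¬ G.Adj w v := by
      rcases hr'.2 with h' | ⟨d, hd, h'⟩
      · simp at h'
      · rw [Mark.colour.injEq] at h'
        subst h'
        rw [mem_seen_update (h.memA ha)] at hd
        exact fun h' => hd (Or.inr ⟨h', rfl⟩)
    refine hkill w hw (fun h' => hvw h'.symm) (fun a haA hav => ?_) _ ?_ ?_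
    · have ha' := mem_erase.2 ⟨hav, haA⟩
      rcases (mem_seen_update hr'.1).1 (hrep a ha') with h' | h'
      · rw [seen_update_of_not_adj (h.memA ha) (h.indepA a haA v ha)] at h'
        exact (notMem_seen_of_unused hc h').elim
      · exact h'.1
    · rw [hr'.unplayed_eq, hr.unplayed_eq]
    · rw [unused_update_of_notMem hr'.1]
      · exact hr.card_unused_le
      · rw [mem_unused_update (h.memA ha)]
        simp

/-! ### Endgames with few insecure vertices -/

lemma mWin_of_last {y : V} (hs : #(seen G p y) < k)
    (h : ∀ v ∈ unplayed p, v ≠ y → Secure G p v) : MWin G p := by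
  by_cases hy : y ∈ unplayed p
  · obtain ⟨c, hc⟩ := exists_notMem_seen hs
    have hr := isReply_colour hy hc
    refine mWin_of_move hy hc (win_of_secure _ fun v hv => ?_)
    rw [hr.unplayed_eq, mem_erase] at hv
    exact (h v hv.2 hv.1).update hr
  · exact win_of_secure _ fun v hv => h v hv fun h' => hy (h' ▸ hv)

/-- Two non-adjacent insecure vertices among four. -/
lemma bWin_of_pair {y y' : V} (hy : y ∈ unplayed p) (hy' : y' ∈ unplayed p) (hne : y' ≠ y)
    (hadj : ¬ G.Adj y y') (h4 : #(unplayed p) = 4) (hU : 2 ≤ #(unused p))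
    (hsec : ∀ v ∈ unplayed p, v ≠ y → v ≠ y' → Secure G p v) : BWin G p := by
  obtain ⟨c, hc⟩ := card_pos.1 (by omega : 0 < #(unused p))
  refine bWin_of_reply ⟨y, hy, c, notMem_seen_of_unused hc⟩ fun w x hr => ?_
  have hsec' : ∀ v ∈ unplayed (update p w x), v ≠ y → v ≠ y' → Secure G (update p w x) v := by
    intro v hv h1 h2
    rw [hr.unplayed_eq, mem_erase] at hv
    exact (hsec v hv.2 h1 h2).update hr
  have hk := card_seen_add_card_unused_le (G := G) (p := p) (v := y)
  have hk' := card_seen_add_card_unused_le (G := G) (p := p) (v := y')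
  have hkr := card_seen_update_le (v := y) hr
  have hkr' := card_seen_update_le (v := y') hr
  by_cases hwy : w = y
  · refine mWin_of_last (y := y') (by omega) fun v hv h => hsec' v hv ?_ h
    rw [hr.unplayed_eq, mem_erase] at hv
    exact hwy ▸ hv.1
  by_cases hwy' : w = y'
  · refine mWin_of_last (y := y) (by omega) fun v hv h => hsec' v hv h ?_
    rw [hr.unplayed_eq, mem_erase] at hv
    exact hwy' ▸ hv.1
  have hyq : y ∈ unplayed (update p w x) := by
    rw [hr.unplayed_eq]; exact mem_erase.2 ⟨Ne.symm hwy, hy⟩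
  have hyq' : y' ∈ unplayed (update p w x) := by
    rw [hr.unplayed_eq]; exact mem_erase.2 ⟨Ne.symm hwy', hy'⟩
  have hUq := hr.card_unused_le
  have h3 := hr.card
  generalize update p w x = q at *
  obtain ⟨d, hd⟩ := card_pos.1 (by omega : 0 < #(unused q))
  have hds : ∀ v, d ∉ seen G q v := fun v => notMem_seen_of_unused hd
  -- A new colour `d` at `z` secures `z'`: it stays legal at `z'` and is blocked at all unplayed
  -- neighbours of `z'`.
  have play : ∀ z z' : V, z ∈ unplayed q → ¬ G.Adj z' z →
      (∀ v ∈ unplayed q, v ≠ z → v ≠ z' → Secure G q v) →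
      (∀ u ∈ unplayed q, u ≠ z → G.Adj z' u → G.Adj u z) → MWin G q := by
    intro z z' hz hzz hsec hall
    have hr' := isReply_colour hz (hds z)
    refine mWin_of_move hz (hds z) (win_of_secure _ fun v hv => ?_)
    rw [hr'.unplayed_eq, mem_erase] at hv
    by_cases hvz : v = z'
    · subst hvz
      refine Or.inr ⟨d, ?_, fun u hu huv => ?_⟩
      · rw [seen_update_of_not_adj hz hzz]
        exact hds v
      · rw [hr'.unplayed_eq, mem_erase] at hu
        exact (mem_seen_update hz).2 (Or.inr ⟨hall u hu.2 hu.1 huv, rfl⟩)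
    · exact (hsec v hv.2 hv.1 hvz).update hr'
  by_cases hall : ∀ u ∈ unplayed q, u ≠ y → G.Adj y' u → G.Adj u y
  · exact play y y' hyq (fun h => hadj h.symm) hsec' hall
  -- Only three vertices are left, so `u` is the third one and `y` has no unplayed neighbour; hence
  -- the roles can be exchanged.
  push Not at hall
  obtain ⟨u, hu, huy, huy', hnadj⟩ := hall
  refine play y' y hyq' hadj (fun v hv h1 h2 => hsec' v hv h2 h1) fun z hz hzy hyz => ?_
  have h1 : z ≠ y := hyz.ne'
  have h2 : u ≠ y' := huy'.ne'
  have h3' : z ≠ u := by rintro rfl; exact hnadj hyz.symm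
  have hcard : #({y, y', u, z} : Finset V) ≤ #(unplayed q) := card_le_card fun v hv => by
    simp only [mem_insert, mem_singleton] at hv
    rcases hv with rfl | rfl | rfl | rfl <;> assumption
  rw [card_insert_of_notMem (by simp [hne.symm, huy.symm, h1.symm]),
    card_insert_of_notMem (by simp [h2.symm, hzy.symm]), card_pair h3'.symm] at hcard
  omega

/-- Two pairs of insecure vertices among seven. -/
lemma mWin_of_two_pairs {b b' y y' : V} (h7 : #(unplayed p) = 7) (hU : 4 ≤ #(unused p))
    (hb : b ∈ unplayed p) (hb' : b' ∈ unplayed p) (hy : y ∈ unplayed p) (hy' : y' ∈ unplayed p)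
    (hbb : b' ≠ b) (hyy : y' ≠ y) (hyb : y ≠ b) (hyb' : y ≠ b') (hy'b : y' ≠ b) (hy'b' : y' ≠ b')
    (hab : ¬ G.Adj b b') (hay : ¬ G.Adj y y')
    (hsec : ∀ v ∈ unplayed p, v ≠ b → v ≠ b' → v ≠ y → v ≠ y' → Secure G p v) : MWin G p := by
  obtain ⟨c, hc⟩ := card_pos.1 (by omega : 0 < #(unused p))
  have hcs : c ∉ seen G p b := notMem_seen_of_unused hc
  have hr := isReply_colour hb hcs
  refine mWin_of_move hb hcs ?_
  have hU1 := card_unused_update_of_mem hb hc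
  have h71 := hr.card
  have hcU : c ∉ unused (update p b (Mark.colour c)) := by
    rw [mem_unused_update hb]; simp
  have hcb' : ∀ d ∈ seen G (update p b (Mark.colour c)) b', d ≠ c := by
    rintro d hd rfl
    rw [seen_update_of_not_adj hb fun h => hab h.symm] at hd
    exact notMem_seen_of_unused hc hd
  have hsec1 : ∀ v ∈ unplayed (update p b (Mark.colour c)), v ≠ b' → v ≠ y → v ≠ y' →
      Secure G (update p b (Mark.colour c)) v := by
    intro v hv h1 h2 h3
    rw [hr.unplayed_eq, mem_erase] at hv
    exact (hsec v hv.2 hv.1 h1 h2 h3).update hr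
  -- The vertex `b'` does not see the colour of `b`, hence has one colour more to spare.
  have hkb' : #(seen G (update p b (Mark.colour c)) b') + 4 ≤ k := by
    rw [seen_update_of_not_adj hb fun h => hab h.symm]
    have := card_seen_add_card_unused_le (G := G) (p := p) (v := b')
    omega
  have hb1 : b' ∈ unplayed (update p b (Mark.colour c)) := by
    rw [hr.unplayed_eq]; exact mem_erase.2 ⟨hbb, hb'⟩
  have hy1 : y ∈ unplayed (update p b (Mark.colour c)) := by
    rw [hr.unplayed_eq]; exact mem_erase.2 ⟨hyb, hy⟩
  have hy1' : y' ∈ unplayed (update p b (Mark.colour c)) := by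
    rw [hr.unplayed_eq]; exact mem_erase.2 ⟨hy'b, hy'⟩
  have hk : ∀ v, #(seen G (update p b (Mark.colour c)) v) + 3 ≤ k := fun v => by
    have := card_seen_add_card_unused_le (G := G) (p := update p b (Mark.colour c)) (v := v)
    omega
  clear hsec hb hb' hy hy' hr hcs
  generalize update p b (Mark.colour c) = q at *
  -- after a move in one pair, Maker plays the first vertex that is in danger
  have rush : ∀ (w : V) (x : Mark k) (z z' : V), IsReply G q w x → z ∈ unplayed (update q w x) →
      #(seen G q z) + 3 ≤ k → #(seen G q z') + 3 ≤ k → (G.Adj z' z → #(seen G q z') + 4 ≤ k) →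
      (∀ v ∈ unplayed (update q w x), v ≠ z → v ≠ z' → Secure G (update q w x) v) →
      MWin G (update q w x) := by
    intro w x z z' hr hz hkz hkz' hkzz hsec
    have h1 := card_seen_update_le (v := z) hr
    have h2 := card_seen_update_le (v := z') hr
    obtain ⟨d, hd⟩ := exists_notMem_seen (G := G) (p := update q w x) (v := z) (by omega)
    have hr2 := isReply_colour hz hd
    refine mWin_of_move hz hd ?_
    -- Before Maker reaches `z'`, it may see one more colour from each of two Breaker moves, and one
    -- from Maker's move if `z` is adjacent.
    have h3 : #(seen G (update (update q w x) z (Mark.colour d)) z') + 2 ≤ k := by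
      by_cases hzz : G.Adj z' z
      · have := card_seen_update_le (v := z') hr2
        have := hkzz hzz
        omega
      · rw [seen_update_of_not_adj hz hzz]
        omega
    have hsec2 : ∀ v ∈ unplayed (update (update q w x) z (Mark.colour d)), v ≠ z' →
        Secure G (update (update q w x) z (Mark.colour d)) v := by
      intro v hv hvz
      rw [hr2.unplayed_eq, mem_erase] at hv
      exact (hsec v hv.2 hv.1 hvz).update hr2
    rcases (unplayed (update (update q w x) z (Mark.colour d))).eq_empty_or_nonempty
      with h0 | ⟨v, hv⟩
    · exact finished_of_unplayed_eq_empty h0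
    refine bWin_of_reply ⟨v, hv, ?_⟩ fun w' x' hr3 => ?_
    · by_cases hvz : v = z'
      · subst hvz
        exact exists_notMem_seen (by omega)
      · exact (hsec2 v hv hvz).exists_legal
    · have h4 := card_seen_update_le (v := z') hr3
      refine mWin_of_last (y := z') (by omega) fun v hv hvz => ?_
      rw [hr3.unplayed_eq, mem_erase] at hv
      exact (hsec2 v hv.2 hvz).update hr3
  obtain ⟨e, he⟩ := card_pos.1 (by omega : 0 < #(unused q))
  refine bWin_of_reply ⟨b', hb1, e, notMem_seen_of_unused he⟩ fun w x hr => ?_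
  have hsec2 : ∀ v ∈ unplayed (update q w x), v ≠ b' → v ≠ y → v ≠ y' →
      Secure G (update q w x) v := by
    intro v hv h1 h2 h3
    rw [hr.unplayed_eq, mem_erase] at hv
    exact (hsec1 v hv.2 h1 h2 h3).update hr
  have hup := hr.unplayed_eq
  have hmem : ∀ v ∈ unplayed q, w ≠ v → v ∈ unplayed (update q w x) := by
    intro v hv hwv
    rw [hup]; exact mem_erase.2 ⟨hwv.symm, hv⟩
  have hnw : ∀ v ∈ unplayed (update q w x), v ≠ w := by
    intro v hv
    rw [hup, mem_erase] at hv
    exact hv.1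
  by_cases hwb : w = b'
  · subst hwb
    exact rush w x y y' hr (hmem y hy1 hyb'.symm) (hk y) (hk y') (fun h => (hay h.symm).elim)
      fun v hv h1 h2 => hsec2 v hv (hnw v hv) h1 h2
  by_cases hwy : w = y
  · subst hwy
    exact rush w x y' b' hr (hmem y' hy1' hyy.symm) (hk y') (hk b') (fun _ => hkb')
      fun v hv h1 h2 => hsec2 v hv h2 (hnw v hv) h1
  by_cases hwy' : w = y'
  · subst hwy'
    exact rush w x y b' hr (hmem y hy1 hyy) (hk y) (hk b') (fun _ => hkb')
      fun v hv h1 h2 => hsec2 v hv h2 h1 (hnw v hv)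
  -- Breaker has played outside both pairs
  have hb2 := hmem b' hb1 hwb
  have hcardq := hr.card
  have fin : ∀ d, d ∉ seen G (update q w x) b' →
      2 ≤ #(unused (update (update q w x) b' (Mark.colour d))) → MWin G (update q w x) := by
    intro d hd hUd
    have hr2 := isReply_colour hb2 hd
    have hup2 := hr2.unplayed_eq
    have hc2 := hr2.card
    refine mWin_of_move hb2 hd (bWin_of_pair (y := y) (y' := y') ?_ ?_ hyy hay (by omega) hUd ?_)
    · rw [hup2]; exact mem_erase.2 ⟨hyb', hmem y hy1 hwy⟩
    · rw [hup2]; exact mem_erase.2 ⟨hy'b', hmem y' hy1' hwy'⟩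
    · intro v hv h1 h2
      rw [hup2, mem_erase] at hv
      exact (hsec2 v hv.2 hv.1 h1 h2).update hr2
  -- Two colours must stay unused for `bWin_of_pair`. If Breaker has spent one, Maker repeats the
  -- colour of `b` at `b'`; otherwise he can afford a new one.
  by_cases hN : ∃ d ∈ unused q, x = Mark.colour d
  · obtain ⟨d, hd, rfl⟩ := hN
    have hUd := card_unused_update_of_mem hr.1 hd
    refine fin c ?_ ?_
    · rw [mem_seen_update hr.1]
      rintro (h | ⟨-, h⟩)
      · exact hcb' c h rfl
      · rw [Mark.colour.injEq] at h
        exact hcU (h ▸ hd)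
    · rw [unused_update_of_notMem hb2]
      · omega
      · rw [mem_unused_update hr.1]
        exact fun h => hcU h.1
  · have hU' : #(unused (update q w x)) = #(unused q) := by
      congr 1
      ext c
      rw [mem_unused_update hr.1, and_iff_left_iff_imp]
      exact fun hc hx => hN ⟨c, hc, hx⟩
    obtain ⟨d, hd⟩ := card_pos.1 (by omega : 0 < #(unused (update q w x)))
    refine fin d (notMem_seen_of_unused hd) ?_
    have := card_unused_update_of_mem hb2 hd
    omega

/-- A bipartite graph with sides of sizes three and four. -/
lemma mWin_of_three_four (h : Fill G p A B (unused p) ∅ ∅) (hA : #A = 3) (hB : #B = 4)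
    (hU : 3 ≤ #(unused p)) : MWin G p := by
  by_cases hrep : ∃ a ∈ A, ∀ w ∈ B, ¬ G.Adj a w → ∃ a' ∈ A, a' ≠ a ∧ ¬ G.Adj a' w
  · obtain ⟨a, ha, hrep⟩ := hrep
    refine mWin_of_repeat h (by omega) (by omega) hU ha fun w hw haw hall => ?_
    obtain ⟨a', ha', hne, hadj⟩ := hrep w hw haw
    exact (hadj (hall a' ha' hne)).elim
  -- Now each `a ∈ A` has an antipode `m a ∈ B`, not adjacent to `a` but adjacent to the rest of
  -- `A`. Antipodes are distinct, and one vertex `z` of `B` is left over.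
  push Not at hrep
  choose! m hmB hma hm using hrep
  have hinj : ∀ a ∈ A, ∀ a' ∈ A, a' ≠ a → m a' ≠ m a := by
    intro a ha a' ha' hne heq
    exact hma a' ha' (heq ▸ hm a ha a' ha' hne)
  have hW : #(A.image m) = 3 := by
    rw [card_image_of_injOn, hA]
    intro a ha a' ha' heq
    by_contra hne
    exact hinj a' ha' a ha hne heq
  obtain ⟨z, hz⟩ : (B \ A.image m).Nonempty := by
    rw [← card_pos]
    have := le_card_sdiff (A.image m) B
    omega
  rw [mem_sdiff] at hz
  obtain ⟨hzB, hzW⟩ := hz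
  have hzm : ∀ a ∈ A, m a ≠ z := by
    rintro a ha rfl
    exact hzW (mem_image_of_mem m ha)
  have hBeq : ∀ w ∈ B, w = z ∨ ∃ a ∈ A, w = m a := by
    have hsub : insert z (A.image m) ⊆ B := by
      intro w hw
      rcases mem_insert.1 hw with rfl | hw
      · exact hzB
      · obtain ⟨a, ha, rfl⟩ := mem_image.1 hw
        exact hmB a ha
    have heq := eq_of_subset_of_card_le hsub (by rw [card_insert_of_notMem hzW]; omega)
    intro w hw
    rw [← heq, mem_insert, mem_image] at hw
    exact hw.imp id fun ⟨a, ha, h⟩ => ⟨a, ha, h.symm⟩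
  have nbrA : ∀ a ∈ A, freeNbrs G p a ⊆ B.erase (m a) := by
    intro a ha u hu
    rw [mem_freeNbrs, h.cover, mem_union] at hu
    refine mem_erase.2 ⟨?_, hu.1.resolve_left fun h' => h.indepA a ha u h' hu.2⟩
    rintro rfl
    exact hma a ha hu.2
  have nbrB : ∀ w ∈ B, ∀ a ∈ A, ¬ G.Adj a w → freeNbrs G p w ⊆ A.erase a := by
    intro w hw a ha haw u hu
    rw [mem_freeNbrs, h.cover, mem_union] at hu
    refine mem_erase.2 ⟨?_, hu.1.resolve_right fun h' => h.indepB w hw u h' hu.2⟩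
    rintro rfl
    exact haw hu.2.symm
  have degB : ∀ w ∈ B, ∀ a ∈ A, ¬ G.Adj a w → #(freeNbrs G p w) < #(unused p) := by
    intro w hw a ha haw
    have h1 := card_le_card (nbrB w hw a ha haw)
    have h2 := card_erase_add_one ha
    omega
  by_cases hcomp : ∃ a ∈ A, ¬ G.Adj a z
  -- Only the two vertices of `A` other than `a` can have more than two free neighbours.
  · obtain ⟨a, ha, haz⟩ := hcomp
    have h1 := card_erase_add_one ha
    obtain ⟨r₁, r₂, -, hr⟩ := card_eq_two.1 (by omega : #(A.erase a) = 2)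
    have hr₁ : r₁ ∈ A.erase a := by simp [hr]
    refine mWin_of_two (r₁ := r₁) (r₂ := r₂) hU (h.memA (mem_of_mem_erase hr₁))
      fun v hv hv1 hv2 => ?_
    rw [h.cover, mem_union] at hv
    rcases hv with hv | hv
    · have hva : v = a := by
        by_contra hva
        have : v ∈ A.erase a := mem_erase.2 ⟨hva, hv⟩
        simp [hr, hv1, hv2] at this
      subst hva
      have hsub : freeNbrs G p v ⊆ (B.erase (m v)).erase z := fun u hu =>
        mem_erase.2 ⟨by rintro rfl; exact haz (mem_freeNbrs.1 hu).2, nbrA v hv hu⟩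
      have h2 := card_le_card hsub
      have h3 := card_erase_erase (hmB v hv) hzB (hzm v hv).symm
      omega
    · rcases hBeq v hv with rfl | ⟨a', ha', rfl⟩
      · exact degB v hv a ha haz
      · exact degB _ hv a' ha' (hma a' ha')
  push Not at hcomp
  -- `z` is complete to `A`
  obtain ⟨c, hc⟩ := card_pos.1 (by omega : 0 < #(unused p))
  have hzp := h.memB hzB
  have hcs : c ∉ seen G p z := notMem_seen_of_unused hc
  have hr := isReply_colour hzp hcs
  have hU1 := card_unused_update_of_mem hzp hc
  obtain ⟨e, he⟩ := card_pos.1 (by omega : 0 < #(unused (update p z (Mark.colour c))))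
  have hup := hr.unplayed_eq
  obtain ⟨a₀, ha₀⟩ := card_pos.1 (by omega : 0 < #A)
  have memA1 : ∀ a ∈ A, a ∈ unplayed (update p z (Mark.colour c)) := by
    intro a ha
    rw [hup]
    exact mem_erase.2 ⟨fun h' => Finset.disjoint_left.1 h.disj ha (h' ▸ hzB), h.memA ha⟩
  refine mWin_of_move hzp hcs
    (bWin_of_reply ⟨a₀, memA1 a₀ ha₀, e, notMem_seen_of_unused he⟩ fun w x hr' => ?_)
  have hup' := hr'.unplayed_eq
  have hw := hr'.1
  rw [hup, mem_erase, h.cover, mem_union] at hw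
  obtain ⟨hwz, hw⟩ := hw
  have secB : ∀ v ∈ B, v ≠ z → Secure G (update (update p z (Mark.colour c)) w x) v := by
    intro v hv hvz
    rcases hBeq v hv with rfl | ⟨a', ha', rfl⟩
    · exact (hvz rfl).elim
    · exact ((secure_of_card_lt (degB _ hv a' ha' (hma a' ha'))).update hr).update hr'
  rcases hw with hw | hw
  · -- Breaker has played `w ∈ A`
    have hmw : m w ∈ unplayed (update (update p z (Mark.colour c)) w x) := by
      rw [hup', hup]
      refine mem_erase.2 ⟨fun h' => ?_, mem_erase.2 ⟨hzm w hw, h.memB (hmB w hw)⟩⟩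
      exact Finset.disjoint_left.1 h.disj hw (h' ▸ hmB w hw)
    have hcm : c ∉ seen G (update (update p z (Mark.colour c)) w x) (m w) := by
      rw [seen_update_of_not_adj hr'.1 fun h' => hma w hw h'.symm,
        seen_update_of_not_adj hzp (h.indepB _ (hmB w hw) _ hzB)]
      exact notMem_seen_of_unused hc
    have hr2 := isReply_colour hmw hcm
    -- Since `z` and `m w` share the colour `c` and `w ∈ A`, the other vertices of `A` see at most
    -- `c` in addition, and each has at most one free neighbour left.
    refine mWin_of_move hmw hcm (win_of_secure _ fun v hv => ?_)
    have hv' := hv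
    rw [hr2.unplayed_eq, hup', hup, mem_erase, mem_erase, mem_erase, h.cover, mem_union] at hv'
    obtain ⟨hvm, hvw, hvz, hv'⟩ := hv'
    rcases hv' with hvA | hvB
    · left
      have h1 : seen G (update (update (update p z (Mark.colour c)) w x) (m w) (Mark.colour c)) v ⊆
          insert c (seen G p v) := by
        refine (seen_update_subset hmw).trans (insert_subset (mem_insert_self _ _) ?_)
        rw [seen_update_of_not_adj hr'.1 (h.indepA v hvA w hw)]
        exact seen_update_subset hzp
      have h2 := (card_le_card h1).trans (card_insert_le _ _)
      have h3 := card_seen_add_card_unused_le (G := G) (p := p) (v := v)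
      have h4 : freeNbrs G (update (update (update p z (Mark.colour c)) w x) (m w)
          (Mark.colour c)) v ⊆ ((B.erase (m v)).erase z).erase (m w) := by
        rw [freeNbrs_update hr2, freeNbrs_update hr', freeNbrs_update hr]
        refine erase_subset_erase _ ((erase_subset _ _).trans ?_)
        exact erase_subset_erase _ (nbrA v hvA)
      have h5 := card_le_card h4
      have h6 := card_erase_erase (hmB v hvA) hzB (hzm v hvA).symm
      have h7 := card_erase_add_one (s := (B.erase (m v)).erase z) (a := m w)
        (mem_erase.2 ⟨hzm w hw, mem_erase.2 ⟨hinj v hvA w hw hvw.symm, hmB w hw⟩⟩)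
      omega
    · exact (secB v hvB hvz).update hr2
  · -- Breaker has played `w = m a`
    rcases hBeq w hw with rfl | ⟨a, ha, rfl⟩
    · exact (hwz rfl).elim
    have hap : a ∈ unplayed (update (update p z (Mark.colour c)) (m a) x) := by
      rw [hup']
      refine mem_erase.2 ⟨fun h' => ?_, memA1 a ha⟩
      exact Finset.disjoint_left.1 h.disj ha (h'.symm ▸ hw)
    have hUq := hr'.card_unused_le
    obtain ⟨d, hd⟩ := card_pos.1
      (by omega : 0 < #(unused (update (update p z (Mark.colour c)) (m a) x)))
    have hds := fun v => notMem_seen_of_unused (G := G) (v := v) hd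
    have hr2 := isReply_colour hap (hds a)
    -- The vertices left in `B` are antipodes of others and so adjacent to `a`: the colour `d` is
    -- blocked at them and stays legal on `A`.
    refine mWin_of_move hap (hds a) (win_of_secure _ fun v hv => ?_)
    have hv' := hv
    rw [hr2.unplayed_eq, hup', hup, mem_erase, mem_erase, mem_erase, h.cover, mem_union] at hv'
    obtain ⟨hva, hvm, hvz, hv'⟩ := hv'
    rcases hv' with hvA | hvB
    · refine Or.inr ⟨d, ?_, fun u hu huv => ?_⟩
      · rw [seen_update_of_not_adj hap (h.indepA v hvA a ha)]
        exact hds v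
      · rw [hr2.unplayed_eq, hup', hup, mem_erase, mem_erase, mem_erase, h.cover, mem_union] at hu
        obtain ⟨hua, hum, huz, hu⟩ := hu
        have huB := hu.resolve_left fun h' => h.indepA v hvA u h' huv
        rcases hBeq u huB with rfl | ⟨a', ha', rfl⟩
        · exact (huz rfl).elim
        · have hne : a ≠ a' := by rintro rfl; exact hum rfl
          exact (mem_seen_update hap).2 (Or.inr ⟨(hm a' ha' a ha hne).symm, rfl⟩)
    · exact (secB v hvB hvz).update hr2

/-- Maker wins at his turn in positions with at most `n` unplayed vertices, an odd number and at
least seven, if he lacks at most two colours. -/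
def OddWinTwo (G : SimpleGraph V) (k n : ℕ) : Prop :=
  ∀ (p : V → Mark k) (b t : ℕ), #(unplayed p) = 2 * b + 1 → #(unplayed p) ≤ n → 3 ≤ b →
    Col G (unplayed p) t → t + b ≤ #(unused p) + 2 → MWin G p

/-- The bipartite case. -/
lemma mWin_of_bipartite {b : ℕ} (hO : OddWinTwo G k (#(unplayed p) - 2))
    (h : Fill G p A B (unused p) ∅ ∅) (hb : #(unplayed p) = 2 * b + 1) (hb3 : 3 ≤ b)
    (hcol : Col G (unplayed p) 2) (hU : b ≤ #(unused p)) (hA2 : 2 ≤ #A) (hAb : #A ≤ b) :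
    MWin G p := by
  by_cases hlt : #A + 1 ≤ #(unused p)
  · exact h.mWin (by simp; omega) (by simp; omega)
  -- What remains is `#A = #(unused p) = b`, one colour short for `Fill.mWin`.
  have hcard := card_union_of_disjoint h.disj
  rw [← h.cover] at hcard
  by_cases hb4 : 4 ≤ b
  · obtain ⟨a, ha⟩ := card_pos.1 (by omega : 0 < #A)
    refine mWin_of_repeat h (by omega) hA2 (by omega) ha fun w hw _ _ q hq hqU => ?_
    have hwa : w ≠ a := by rintro rfl; exact Finset.disjoint_left.1 h.disj ha hw
    have hc := card_erase_erase (h.memA ha) (h.memB hw) hwa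
    rw [← hq] at hc
    refine hO q (b - 1) 2 (by omega) (by omega) (by omega) ?_ (by omega)
    rw [hq]
    exact hcol.mono ((erase_subset _ _).trans (erase_subset _ _))
  · exact mWin_of_three_four h (by omega) (by omega) (by omega)

/-- Otherwise `#S` would be a sum of even numbers. -/
lemma exists_odd_class (ho : ¬ Even #S) : ∃ v ∈ S, Odd #{u ∈ S | g u = g v} := by
  by_contra! h
  refine ho ?_
  rw [card_eq_sum_card_image g S]
  refine even_sum _ fun d hd => ?_
  obtain ⟨v, hv, rfl⟩ := mem_image.1 hd
  exact Nat.not_odd_iff_even.1 (h v hv)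

/-- The case of at least three colour classes of size at least two. -/
lemma mWin_of_fat_odd {b : ℕ} (hO : OddWinTwo G k (#(unplayed p) - 2))
    (hb : #(unplayed p) = 2 * b + 1) (hb3 : 3 ≤ b) (hg : ProperOn G (unplayed p) g)
    (ht : #((unplayed p).image g) ≤ t) (hU : t + b ≤ #(unused p) + 2)
    (hfat : Fat (unplayed p) g) (h3 : 3 ≤ #((unplayed p).image g)) : MWin G p := by
  obtain ⟨v, hv, ho⟩ := exists_odd_class (g := g) (S := unplayed p)
    (by rw [Nat.not_even_iff_odd, hb]; exact odd_two_mul_add_one b)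
  have hcv := card_class_add (unplayed p) g v
  have h2v := hfat.two_le_class hv
  have hthird : ∀ w ∈ unplayed p, g w ≠ g v →
      2 ≤ #{u ∈ {u ∈ unplayed p | g u ≠ g v} | g u ≠ g w} := by
    intro w hw hgw
    have h1 : ∃ d ∈ (unplayed p).image g, d ∉ ({g v, g w} : Finset ℕ) :=
      exists_mem_notMem_of_card_lt_card (lt_of_le_of_lt card_le_two (by omega))
    obtain ⟨d, hd, hd'⟩ := h1
    obtain ⟨z, hz, rfl⟩ := mem_image.1 hd
    simp only [mem_insert, mem_singleton, not_or] at hd'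
    refine (hfat.two_le_class hz).trans (card_le_card fun u hu => ?_)
    simp only [mem_filter] at hu ⊢
    exact ⟨⟨hu.1, hu.2 ▸ hd'.1⟩, hu.2 ▸ hd'.2⟩
  have hF : 4 ≤ #{u ∈ unplayed p | g u ≠ g v} := by
    obtain ⟨w, hw, hgw⟩ := (hfat v hv).2
    have h1 := hthird w hw hgw
    have h2 := card_class_add {u ∈ unplayed p | g u ≠ g v} g w
    have h3 : #{u ∈ unplayed p | g u = g w} ≤ #{u ∈ {u ∈ unplayed p | g u ≠ g v} | g u = g w} :=
      card_le_card fun u hu => by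
        simp only [mem_filter] at hu ⊢
        exact ⟨⟨hu.1, hu.2 ▸ hgw⟩, hu.2⟩
    have h4 := hfat.two_le_class hw
    omega
  by_cases hb4 : 4 ≤ b
  · refine mWin_first_odd hb hg ht hU hv ho hF (fun _ => hthird)
      fun _ w hw hgw _ q hq hqU => ?_
    have hwv : w ≠ v := by rintro rfl; exact hgw rfl
    have hc := card_erase_erase hv hw hwv
    rw [← hq] at hc
    refine hO q (b - 1) t (by omega) (by omega) (by omega) ?_ (by omega)
    rw [hq]
    exact Col.mono ⟨g, hg, ht⟩ ((erase_subset _ _).trans (erase_subset _ _))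
  -- On seven vertices an attack would leave five, too few for the induction. The classes have sizes
  -- 3, 2 and 2.
  have hc3 : #{u ∈ unplayed p | g u = g v} = 3 := by
    obtain ⟨a, ha⟩ := ho
    omega
  by_cases hdom : ∃ y ∈ unplayed p, g y = g v ∧ ∀ w ∈ unplayed p, g w ≠ g v → G.Adj y w
  · obtain ⟨y, hy, hgy, hdom⟩ := hdom
    rw [← hgy] at ho hF hthird hdom
    exact mWin_first_odd hb hg ht hU hy ho hF (fun _ => hthird)
      fun _ w hw hgw hyw => (hyw (hdom w hw hgw)).elim
  push Not at hdom
  obtain ⟨w, hw, hgw⟩ := (hfat v hv).2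
  obtain ⟨z, hz⟩ := card_pos.1 (two_pos.trans_le (hthird w hw hgw))
  simp only [mem_filter] at hz
  obtain ⟨⟨hz, hgzv⟩, hgzw⟩ := hz
  have h2w := hfat.two_le_class hw
  have h2z := hfat.two_le_class hz
  have hdisj : Disjoint ({u ∈ unplayed p | g u = g w} : Finset V) {u ∈ unplayed p | g u = g z} :=
    disjoint_filter.2 fun u _ h h' => hgzw (h'.symm.trans h)
  have hsub : ({u ∈ unplayed p | g u = g w} : Finset V) ∪ {u ∈ unplayed p | g u = g z} ⊆
      {u ∈ unplayed p | g u ≠ g v} := by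
    intro u hu
    simp only [mem_union, mem_filter] at hu ⊢
    rcases hu with hu | hu
    · exact ⟨hu.1, hu.2 ▸ hgw⟩
    · exact ⟨hu.1, hu.2 ▸ hgzv⟩
  have hle := card_le_card hsub
  rw [card_union_of_disjoint hdisj] at hle
  obtain ⟨w', hw', hww', hgw', hwu⟩ := exists_eq_pair (g := g) hw (by omega)
  obtain ⟨z', hz', hzz', hgz', hzu⟩ := exists_eq_pair (g := g) hz (by omega)
  have heq := eq_of_subset_of_card_le hsub (by rw [card_union_of_disjoint hdisj]; omega)
  have hne : ∀ {a b : V}, g a = g z → g b = g w → a ≠ b := by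
    rintro a b h1 h2 rfl
    exact hgzw (h1.symm.trans h2)
  refine mWin_of_two_pairs (b := w) (b' := w') (y := z) (y' := z') (by omega) (by omega) hw hw'
    hz hz' hww' hzz' (hne rfl rfl) (hne rfl hgw') (hne hgz' rfl) (hne hgz' hgw')
    (fun h => hg w hw w' hw' h hgw'.symm) (fun h => hg z hz z' hz' h hgz'.symm)
    fun u hu h1 h2 h3 h4 => secure_of_card_lt ?_
  have hgu : g u = g v := by
    by_contra hgu
    have : u ∈ ({u ∈ unplayed p | g u ≠ g v} : Finset V) := mem_filter.2 ⟨hu, hgu⟩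
    rw [← heq, mem_union, mem_filter, mem_filter] at this
    rcases this with h | h
    · exact (hwu u hu h.2).elim h1 h2
    · exact (hzu u hu h.2).elim h3 h4
  -- Vertices of the triple miss one of the four others, so they have at most three free neighbours
  -- while four colours are unused.
  obtain ⟨y, hy, hgy, huy⟩ := hdom u hu hgu
  have h5 : freeNbrs G p u ⊂ {u ∈ unplayed p | g u ≠ g v} := by
    refine (ssubset_iff_of_subset ?_).2 ⟨y, mem_filter.2 ⟨hy, hgy⟩, fun h => huy
      (mem_freeNbrs.1 h).2⟩
    rw [← hgu]
    exact freeNbrs_subset hg hu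
  have h6 := card_lt_card h5
  omega

/-- Maker opens in an odd class, whose rest is even, so that Breaker never takes its last vertex.
When all classes have at least two vertices this needs three classes; two form a bipartite graph. -/
lemma oddWinTwo (G : SimpleGraph V) (k n : ℕ) : OddWinTwo G k n := by
  induction n using Nat.strong_induction_on with
  | _ n ih =>
  intro p b t hb hn hb3 ⟨g, hg, ht⟩ hU
  have hne : (unplayed p).Nonempty := card_pos.1 (by omega)
  have ht1 : 1 ≤ t := (card_pos.2 (hne.image g)).trans_le ht
  by_cases hind : ∃ v ∈ unplayed p, ∀ u ∈ unplayed p, g u = g v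
  · obtain ⟨v, hv, hind⟩ := hind
    refine win_of_indep_of_unused _ (fun u hu w hw h => ?_) (by omega)
    exact hg u hu w hw h ((hind u hu).trans (hind w hw).symm)
  push Not at hind
  by_cases hsing : ∃ v ∈ unplayed p, ∀ u ∈ unplayed p, u ≠ v → g u ≠ g v
  · obtain ⟨v, hv, hsing⟩ := hsing
    have hcls : ({u ∈ unplayed p | g u = g v} : Finset V) = {v} := by
      ext u
      simp only [mem_filter, mem_singleton]
      constructor
      · rintro ⟨hu, h⟩
        by_contra huv
        exact hsing u hu huv h
      · rintro rfl
        exact ⟨hv, rfl⟩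
    have hc := card_class_add (unplayed p) g v
    rw [hcls, card_singleton] at hc
    refine mWin_first_odd hb hg ht hU hv (by rw [hcls, card_singleton]; exact odd_one) (by omega)
      ?_ ?_ <;>
    · rintro ⟨u, hu, huv, hgu⟩
      exact (hsing u hu huv hgu).elim
  push Not at hsing
  have hfat : Fat (unplayed p) g := fun v hv => ⟨hsing v hv, hind v hv⟩
  have hO := ih (#(unplayed p) - 2) (by omega)
  by_cases h3 : 3 ≤ #((unplayed p).image g)
  · exact mWin_of_fat_odd hO hb hb3 hg ht hU hfat h3
  obtain ⟨v, hv⟩ := hne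
  have h2 := hfat.two_le_image hv
  have hcv := card_class_add (unplayed p) g v
  have h2v := hfat.two_le_class hv
  have h2v' := hfat.two_le_compl hv
  have hfill : Fill G p {u ∈ unplayed p | g u = g v} {u ∈ unplayed p | g u ≠ g v}
      (unused p) ∅ ∅ := by
    constructor
    · exact (filter_union_filter_not_eq _ _).symm
    · exact disjoint_filter_filter_not _ _ _
    · intro u hu w hw h
      rw [mem_filter] at hu hw
      exact hg u hu.1 w hw.1 h (hu.2.trans hw.2.symm)
    · intro u hu w hw h
      rw [mem_filter] at hu hw
      have hgu := hg u hu.1 w hw.1 h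
      refine h3 ?_
      have : ({g v, g u, g w} : Finset ℕ) ⊆ (unplayed p).image g := by
        intro d hd
        simp only [mem_insert, mem_singleton] at hd
        rcases hd with rfl | rfl | rfl
        · exact mem_image_of_mem g hv
        · exact mem_image_of_mem g hu.1
        · exact mem_image_of_mem g hw.1
      have h4 := card_le_card this
      rwa [card_insert_of_notMem (by simp [hu.2.symm, hw.2.symm]), card_pair hgu] at h4
    · exact fun w _ d hd hs => (notMem_seen_of_unused hd hs).elim
    · exact fun w _ d hd hs => (notMem_seen_of_unused hd hs).elim
  have hcol : Col G (unplayed p) 2 := ⟨g, hg, by omega⟩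
  by_cases hle : #{u ∈ unplayed p | g u = g v} ≤ b
  · exact mWin_of_bipartite hO hfill hb hb3 hcol (by omega) h2v hle
  · exact mWin_of_bipartite hO hfill.symm hb hb3 hcol (by omega) h2v' (by omega)

/-! ### The initial position -/

lemma unplayed_start : unplayed (fun _ : V => (Mark.unplayed : Mark k)) = univ := by
  ext; simp [mem_unplayed]

lemma card_unused_start : #(unused (fun _ : V => (Mark.unplayed : Mark k))) = k := by
  have : unused (fun _ : V => (Mark.unplayed : Mark k)) = univ := by
    ext; simp [mem_unused]
  rw [this, card_univ, Fintype.card_fin]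

/-- A cocktail party graph is a Turán graph. -/
lemma Cocktail.exists_iso_turanGraph (h : Cocktail G univ) :
    ∃ r, Nonempty (G ≃g turanGraph (2 * r) r) := by
  classical
  have hm : ∀ v, ∃ u, u ≠ v ∧ ¬ G.Adj v u ∧ ∀ w, w ≠ v → ¬ G.Adj v w → w = u := fun v => by
    obtain ⟨u, -, hu⟩ := h v (mem_univ v)
    exact ⟨u, hu.1, hu.2.1, fun w => hu.2.2 w (mem_univ w)⟩
  -- Uniqueness of the non-neighbour makes non-adjacency transitive.
  let s : Setoid V :=
    { r := fun u v => ¬ G.Adj u v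
      iseqv :=
        { refl := fun v => G.irrefl
          symm := fun h h' => h h'.symm
          trans := fun {u v w} huv hvw huw => by
            obtain ⟨m, -, -, hmu⟩ := hm v
            have h1 : u ≠ v := by rintro rfl; exact hvw huw
            have h2 : w ≠ v := by rintro rfl; exact huv huw
            have h3 := hmu u h1 fun h => huv h.symm
            have h4 := hmu w h2 hvw
            exact huw.ne (h3.trans h4.symm) } }
  have hs : ∀ u v, (Quotient.mk s u = Quotient.mk s v) ↔ ¬ G.Adj u v := fun u v => Quotient.eq
  have hfib : ∀ q : Quotient s, Fintype.card {v // Quotient.mk s v = q} = 2 := by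
    intro q
    induction q using Quotient.inductionOn with
    | _ v =>
    obtain ⟨u, huv, hadj, huniq⟩ := hm v
    rw [Fintype.card_subtype, card_eq_two]
    refine ⟨v, u, huv.symm, ?_⟩
    ext w
    simp only [mem_filter, mem_univ, true_and, mem_insert, mem_singleton, hs]
    constructor
    · intro hw
      by_cases hwv : w = v
      · exact Or.inl hwv
      · exact Or.inr (huniq w hwv fun h => hw h.symm)
    · rintro (rfl | rfl)
      · exact G.irrefl
      · exact fun h => hadj h.symm
  let ψ : ∀ q : Quotient s, {v // Quotient.mk s v = q} ≃ Fin 2 := fun q =>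
    Fintype.equivFinOfCardEq (hfib q)
  let e : Quotient s ≃ Fin (Fintype.card (Quotient s)) := Fintype.equivFin _
  -- In `turanGraph` adjacency means different residues; `finProdFinEquiv` makes the index of a
  -- class the residue of its vertices.
  refine ⟨Fintype.card (Quotient s), ⟨⟨(Equiv.sigmaFiberEquiv (Quotient.mk s)).symm.trans
    ((Equiv.sigmaCongrRight ψ).trans ((Equiv.sigmaEquivProd _ _).trans
      ((Equiv.prodComm _ _).trans (((Equiv.refl _).prodCongr e).trans finProdFinEquiv)))), ?_⟩⟩⟩
  intro u v
  have hlt : ∀ q, (e q : ℕ) % Fintype.card (Quotient s) = e q := fun q =>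
    Nat.mod_eq_of_lt (e q).isLt
  simp only [turanGraph, Equiv.trans_apply, Equiv.prodComm_apply, Equiv.prodCongr_apply,
    finProdFinEquiv_apply_val]
  simp [Equiv.sigmaFiberEquiv, hlt, Fin.val_inj, hs]

end ColouringGame

/-! ### The bounds for the game chromatic numbers -/

open ColouringGame in
lemma gameChromaticNumber_le_blanks {V : Type*} [DecidableEq V] (G : SimpleGraph V) :
    G.gameChromaticNumber ≤ G.gameChromaticNumberBlanks :=
  le_iInf₂ fun k hk => iInf₂_le k (makerWins_false hk)

open ColouringGame in
lemma gameChromaticNumberBlanks_add_two_le {V : Type*} [Fintype V] [DecidableEq V]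
    (G : SimpleGraph V) (hV : 6 ≤ Fintype.card V)
    (hG : ¬ ∃ r : ℕ, Nonempty (G ≃g SimpleGraph.turanGraph (2 * r) r)) :
    G.gameChromaticNumberBlanks + 2 ≤ G.chromaticNumber + ((Fintype.card V / 2 : ℕ) : ℕ∞) := by
  obtain ⟨t, ht⟩ := ENat.ne_top_iff_exists.1
    (chromaticNumber_ne_top_iff_exists.2 ⟨_, G.colorable_of_fintype⟩)
  obtain ⟨C⟩ : G.Colorable t := chromaticNumber_le_iff_colorable.1 ht.ge
  -- At the start all `k` colours are unused, so this is exactly the balance of `EvenWin` and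
  -- `OddWinTwo`.
  obtain ⟨k, hk⟩ : ∃ k, k + 2 = t + Fintype.card V / 2 :=
    ⟨t + Fintype.card V / 2 - 2, by omega⟩
  have hcol : Col G Finset.univ t := by
    refine ⟨fun v => C v, fun u _ v _ h h' => C.valid h (Fin.ext h'), ?_⟩
    refine (Finset.card_le_card (t := Finset.range t) fun d hd => ?_).trans
      (Finset.card_range t).le
    obtain ⟨v, -, rfl⟩ := Finset.mem_image.1 hd
    exact Finset.mem_range.2 (C v).isLt
  have hwin : MWin G (fun _ : V => (Mark.unplayed : Mark k)) := by
    have hU := card_unused_start (V := V) (k := k)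
    have hc : (unplayed (fun _ : V => (Mark.unplayed : Mark k))).card = Fintype.card V := by
      rw [unplayed_start, Finset.card_univ]
    rcases Nat.even_or_odd' (Fintype.card V) with ⟨b, hb | hb⟩
    · refine evenWin G k _ _ b t (by omega) le_rfl (by omega) ?_ ?_ (by omega)
      · rw [unplayed_start]
        exact fun h => hG h.exists_iso_turanGraph
      · rwa [unplayed_start]
    · refine oddWinTwo G k _ _ b t (by omega) le_rfl (by omega) ?_ (by omega)
      rwa [unplayed_start]
  have hle : G.gameChromaticNumberBlanks ≤ (k : ℕ∞) := iInf₂_le k hwin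
  calc G.gameChromaticNumberBlanks + 2 ≤ (k : ℕ∞) + 2 := by gcongr
    _ = ((k + 2 : ℕ) : ℕ∞) := by push_cast; rfl
    _ = G.chromaticNumber + ((Fintype.card V / 2 : ℕ) : ℕ∞) := by rw [hk, ← ht]; push_cast; rfl

end SimpleGraph

theorem mainTheorem2 {V : Type*} [Fintype V] [DecidableEq V] (G : SimpleGraph V) :
    G.gameChromaticNumber ≤ G.gameChromaticNumberBlanks ∧
    (6 ≤ Fintype.card V →
      (¬ ∃ r : ℕ, Nonempty (G ≃g SimpleGraph.turanGraph (2 * r) r)) →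
      G.gameChromaticNumberBlanks + 2 ≤
          G.chromaticNumber + ((Fintype.card V / 2 : ℕ) : ℕ∞) ∧
      G.gameChromaticNumber + 2 ≤
          G.chromaticNumber + ((Fintype.card V / 2 : ℕ) : ℕ∞)) := by
  have h := G.gameChromaticNumber_le_blanks
  refine ⟨h, fun hV hG => ?_⟩
  have h2 := G.gameChromaticNumberBlanks_add_two_le hV hG
  exact ⟨h2, (by gcongr : _ ≤ _).trans h2⟩
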